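/- **Setting.** Let $W^1,W^2,\dots$ be independent standard Brownian motions on a probability space $(\Omega,\mathcal F,P)$, let $\mathcal F_0\subset\mathcal F$ be a $\sigma$-field independent of them, and $\mathcal F_t=\mathcal F_0\vee\sigma(W^j_s: j\ge 1,\ s\le t)$. Let $\Theta^0=(\Theta^0_{ij})_{i,j\ge1}$, $\sigma^0=(\sigma^0_i)_{i\ge1}$ be real arrays and $\phi_i:\mathbb R\to\mathbb R$ $(i\ge1)$ functions. For each $n$ let $p_n\in\mathbb N$ and let $X=X^{(n)}$ be a continuous adapted $\mathbb R^{p_n}$-valued process with $\mathcal F_0$-measurable initial value such that, almost surely, for all $t\ge0$ and $1\le i\le p_n$, $$X^i_t=X^i_0+\int_0^t\sum_{j=1}^{p_n}\Theta^0_{ij}\phi_j(X^j_s)\,ds+\sigma^0_iW^i_t .$$ $X^{(n)}$ is observed at the times $t^n_k=k\Delta_n$, $0\le k\le n$, where $\Delta_n>0$ for $n\ge1$. Write $\Theta_i^0=(\Theta^0_{ij})_{j\le p_n}\in\mathbb R^{p_n}$, $T_0^i=\{j\le p_n:\Theta^0_{ij}\ne0\}$ and $\phi(x)=(\phi_1(x_1),\dots,\phi_{p_n}(x_{p_n}))$.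 Assume $\sup_{i\ge1}\#\{j\ge 1:\Theta^0_{ij}\neq0\}=S^*$ for an integer $0<S^*<\infty$. **Assumptions.** (i) $p_n\to\infty$, $\log p_n=o(\sqrt{n\Delta_n})$ and $\Delta_n\asymp n^{-\alpha}$ for some $\alpha\in(1/2,1)$. (ii) There are $L,L'>0$ with $|\phi_i(x)|\le L$ and $|\phi_i(x)-\phi_i(y)|\le L'|x-y|$ for all $i,x,y$. (iii) For every $\nu\ge1$, $\sup_{n}\sup_{i\le p_n}\sup_{t\ge0}E|X^i_t|^\nu<\infty$. (iv) There are $K_1,\dots,K_4>0$ with $|\Theta^0_{ij}|< K_1$ for all $i,j$, $|\Theta^0_{ij}|> K_2$ whenever $\Theta^0_{ij}\ne0$, and $K_4<|\sigma^0_i|<K_3$ for all $i$. (v) For all $n$ and $i\le p_n$ the process $(X^j)_{j\in T_0^i}$ is ergodic: there is a probability measure $\mu$ on $\mathbb R^{T^i_0}$ such that for every bounded continuous $f$, $\frac1T\int_0^Tf\big((X_t^j)_{j\in T_0^i}\big)dt\to\int f\,d\mu$ in probability as $T\to\infty$. **Estimator.** For $i\le p_n$ put $\hat\sigma_i^2=\frac1{n\Delta_n}\sum_{k=1}^n|X^i_{t_k^n}-X^i_{t_{k-1}^n}|^2$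 and $$\psi^i_n(\theta)=\frac1{n\Delta_n\hat\sigma_i^2}\sum_{k=1}^n\phi(X_{t_{k-1}^n})\big(X^i_{t_k^n}-X^i_{t_{k-1}^n}-\theta^T\phi(X_{t^n_{k-1}})\Delta_n\big),\qquad V_n^i=\frac1{n\hat\sigma_i^2}\sum_{k=1}^n\phi(X_{t_{k-1}^n})\phi(X_{t_{k-1}^n})^T .$$ Let $\gamma_n>0$ with $\gamma_n\asymp\log(1+p_n^2)/\sqrt{n\Delta_n}$. Almost surely, for every $i\le p_n$, let $\hat\Theta_i$ be a Dantzig selector, that is, any minimizer of $\|\theta\|_1$ over $\{\theta\in\mathbb R^{p_n}:\|\psi^i_n(\theta)\|_\infty\le\gamma_n\}$. **Factors.** For $T\subset\{1,\dots,p_n\}$ and a $p_n\times p_n$ matrix $V$ let $C_T=\{h\in\mathbb R^{p_n}:\|h_{T^c}\|_1\le\|h_T\|_1\}$ and $$\kappa(T,V)=\inf_{0\ne h\in C_T}\frac{|T|^{1/2}(h^TVh)^{1/2}}{\|h_T\|_1},\quad RE(T,V)=\inf_{0\ne h\in C_T}\frac{(h^TVh)^{1/2}}{\|h\|_2},\quad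 F_\infty(T,V)=\inf_{0\ne h\in C_T}\frac{(h^TVh)^{1/2}}{\|h\|_\infty},$$ with $\inf\emptyset=+\infty$. Assume moreover that for every $\epsilon>0$ there are $\delta>0$ and $n_0$ such that $P\big(\inf_{i\le p_n}\kappa(T_0^i,V_n^i)>\delta\big)\ge1-\epsilon$ for all $n\ge n_0$. **Conclusion.** (i) $$\lim_{n\to\infty}P\Big(\sup_{i\le p_n}\|\hat\Theta_i-\Theta_i^0\|_2^2\ \ge\ \frac{4\sup_{i\le p_n}\|\Theta_i^0\|_1\,\gamma_n}{\inf_{i\le p_n}RE^2(T_0^i,V_n^i)}\Big)=0,$$ and $\sup_{i\le p_n}\|\hat\Theta_i-\Theta^0_i\|_2\to0$ in probability. (ii) $$\lim_{n\to\infty}P\Big(\sup_{i\le p_n}\|\hat\Theta_i-\Theta_i^0\|_\infty^2\ \ge\ \frac{4\sup_{i\le p_n}\|\Theta_i^0\|_1\,\gamma_n}{\inf_{i\le p_n}F_\infty^2(T_0^i,V_n^i)}\Big)=0,$$ and $\sup_{i\le p_n}\|\hat\Theta_i-\Theta^0_i\|_\infty\to0$ in probability. -/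

import Mathlib

open MeasureTheory ProbabilityTheory Filter Topology Asymptotics
open scoped NNReal ENNReal BoundedContinuousFunction

namespace SparseDiffusion

noncomputable section

/-! ### Vectors -/

/-- The `l_1` norm. -/
def l1Norm {d : ℕ} (v : Fin d → ℝ) : ℝ := ∑ j, |v j|

/-- The `l_2` norm. (The `l_∞` norm is the norm `‖v‖` of the function type `Fin d → ℝ`.) -/
def l2Norm {d : ℕ} (v : Fin d → ℝ) : ℝ := √(∑ j, v j ^ 2)

/-- The first `d` entries of the `i`-th row of an infinite matrix. -/
def row (Θ : ℕ → ℕ → ℝ) {d : ℕ} (i : Fin d) : Fin d → ℝ := fun j => Θ i j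

/-- The support of the `i`-th row inside `{1, …, d}`. -/
def rowSupport (Θ : ℕ → ℕ → ℝ) {d : ℕ} (i : Fin d) : Finset (Fin d) :=
  Finset.univ.filter fun j => row Θ i j ≠ 0

/-! ### The stochastic basis and the diffusion model -/

/-- The information at time `t`: `F₀ ∨ σ(W_s^j : j ∈ ℕ, s ≤ t)`. -/
@[reducible]
def history {Ω : Type*} (F₀ : MeasurableSpace Ω) (W : ℕ → ℝ≥0 → Ω → ℝ) (t : ℝ≥0) :
    MeasurableSpace Ω :=
  F₀ ⊔ ⨆ (j : ℕ) (s : ℝ≥0) (_ : s ≤ t), MeasurableSpace.comap (W j s) (borel ℝ)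

/-- `W^1, W^2, …` are independent standard Brownian motions and `F₀` is a sub-σ-field that is
independent of all of them. -/
structure IsBrownianBasis {Ω : Type*} (F₀ : MeasurableSpace Ω) [mΩ : MeasurableSpace Ω]
    (P : Measure Ω) (W : ℕ → ℝ≥0 → Ω → ℝ) : Prop where
  initial_le : F₀ ≤ mΩ
  measurable : ∀ j t, Measurable (W j t)
  brownian : ∀ j, IsBrownianReal (W j) P
  independent : iIndep (fun j => ⨆ t, MeasurableSpace.comap (W j t) (borel ℝ)) P
  initial_indep :
    Indep F₀ (⨆ (j : ℕ) (t : ℝ≥0), MeasurableSpace.comap (W j t) (borel ℝ)) P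

/-- `X` is a (continuous, adapted) solution of the `d`-dimensional equation
`X_t^i = X_0^i + ∫_0^t ∑_{j ≤ d} Θ_ij φ_j(X_s^j) ds + σ_i W_t^i`, `i ≤ d`,
whose initial value is `F₀`-measurable. -/
structure IsSolution {Ω : Type*} (F₀ : MeasurableSpace Ω) [MeasurableSpace Ω]
    (P : Measure Ω) (W : ℕ → ℝ≥0 → Ω → ℝ) (φ : ℕ → ℝ → ℝ) (Θ : ℕ → ℕ → ℝ) (σ : ℕ → ℝ)
    {d : ℕ} (X : ℝ≥0 → Ω → Fin d → ℝ) : Prop where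
  initial : ∀ i, Measurable[F₀] fun ω => X 0 ω i
  adapted : ∀ t i, Measurable[history F₀ W t] fun ω => X t ω i
  continuous : ∀ᵐ ω ∂P, Continuous fun t => X t ω
  equation : ∀ᵐ ω ∂P, ∀ (t : ℝ≥0) (i : Fin d),
    X t ω i = X 0 ω i
      + (∫ s in (0 : ℝ)..t, ∑ j : Fin d, Θ i j * φ j (X s.toNNReal ω j))
      + σ i * W i t ω

/-- The process `Y` is ergodic with invariant measure `μ`: time averages of bounded continuous
functions of `Y` converge in probability to their `μ`-integrals. -/
def IsErgodicProcess {Ω ι : Type*} [MeasurableSpace Ω] (P : Measure Ω)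
    (Y : ℝ≥0 → Ω → ι → ℝ) (μ : Measure (ι → ℝ)) : Prop :=
  ∀ f : (ι → ℝ) →ᵇ ℝ,
    TendstoInMeasure P
      (fun (T : ℝ) ω => T⁻¹ * ∫ t in (0 : ℝ)..T, f (Y t.toNNReal ω)) atTop
      (fun _ => ∫ y, f y ∂μ)

/-- The regularity assumptions on the dimension `p n`, the step `Δ n` of the observation times
`t_k = k Δ_n`, the functions `φ_i`, the true values `Θ`, `σ` and the processes
`X n = (X^1, …, X^{p n})`. -/
structure Regularity {Ω : Type*} [MeasurableSpace Ω] (P : Measure Ω) (p : ℕ → ℕ) (Δ : ℕ → ℝ)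
    (φ : ℕ → ℝ → ℝ) (Θ : ℕ → ℕ → ℝ) (σ : ℕ → ℝ) (X : (n : ℕ) → ℝ≥0 → Ω → Fin (p n) → ℝ) :
    Prop where
  dim_tendsto : Tendsto p atTop atTop
  log_dim : (fun n => Real.log (p n)) =o[atTop] fun n => √(n * Δ n)
  step_pos : ∀ n, 1 ≤ n → 0 < Δ n
  step_order : ∃ α : ℝ, 1 / 2 < α ∧ α < 1 ∧ Δ =Θ[atTop] fun n => (n : ℝ) ^ (-α)
  bounded : ∃ L : ℝ, 0 < L ∧ ∀ i x, |φ i x| ≤ L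
  lipschitz : ∃ L' : ℝ, 0 < L' ∧ ∀ i x y, |φ i x - φ i y| ≤ L' * |x - y|
  moments : ∀ ν : ℝ, 1 ≤ ν → ∃ C : ℝ, ∀ n t (i : Fin (p n)),
    ∫⁻ ω, ‖X n t ω i‖ₑ ^ ν ∂P ≤ ENNReal.ofReal C
  drift_bounds : ∃ K₁ K₂ : ℝ, 0 < K₁ ∧ 0 < K₂ ∧
    (∀ i j, |Θ i j| < K₁) ∧ ∀ i j, Θ i j ≠ 0 → K₂ < |Θ i j|
  diffusion_bounds : ∃ K₃ K₄ : ℝ, 0 < K₃ ∧ 0 < K₄ ∧ ∀ i, K₄ < |σ i| ∧ |σ i| < K₃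
  ergodic : ∀ n (i : Fin (p n)), ∃ μ : Measure (rowSupport Θ i → ℝ),
    IsProbabilityMeasure μ ∧ IsErgodicProcess P (fun t ω (j : rowSupport Θ i) => X n t ω j) μ

/-! ### Estimators, as functions of the observed path -/

/-- The `k`-th observation of the path `x`, made at time `k δ`. -/
def obs {d : ℕ} (x : ℝ≥0 → Fin d → ℝ) (δ : ℝ) (k : ℕ) : Fin d → ℝ := x (k * δ).toNNReal

/-- `σ̂_i² = (n δ)⁻¹ ∑_{k=1}^n |X^i_{t_k} - X^i_{t_{k-1}}|²`. -/
def sigmaHatSq {d : ℕ} (n : ℕ) (δ : ℝ) (x : ℝ≥0 → Fin d → ℝ) (i : Fin d) : ℝ :=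
  1 / (n * δ) * ∑ k ∈ Finset.range n, |obs x δ (k + 1) i - obs x δ k i| ^ 2

/-- The quasi-score `ψ_n(θ)` for the `i`-th row, a vector in `ℝ^d`. -/
def score {d : ℕ} (φ : ℕ → ℝ → ℝ) (n : ℕ) (δ : ℝ) (x : ℝ≥0 → Fin d → ℝ) (i : Fin d)
    (θ : Fin d → ℝ) : Fin d → ℝ := fun j =>
  1 / (n * δ * sigmaHatSq n δ x i) * ∑ k ∈ Finset.range n, φ j (obs x δ k j) *
    (obs x δ (k + 1) i - obs x δ k i - (∑ l, θ l * φ l (obs x δ k l)) * δ)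

/-- The matrix `V_n^i = (n σ̂_i²)⁻¹ ∑_{k=1}^n φ(X_{t_{k-1}}) φ(X_{t_{k-1}})ᵀ`. -/
def hessian {d : ℕ} (φ : ℕ → ℝ → ℝ) (n : ℕ) (δ : ℝ) (x : ℝ≥0 → Fin d → ℝ) (i : Fin d) :
    Matrix (Fin d) (Fin d) ℝ := Matrix.of fun j l =>
  1 / (n * sigmaHatSq n δ x i) *
    ∑ k ∈ Finset.range n, φ j (obs x δ k j) * φ l (obs x δ k l)

/-- The constraint set `𝒞_n^i = {θ : ‖ψ_n(θ)‖_∞ ≤ γ}`. -/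
def constraintSet {d : ℕ} (φ : ℕ → ℝ → ℝ) (n : ℕ) (δ γ : ℝ) (x : ℝ≥0 → Fin d → ℝ)
    (i : Fin d) : Set (Fin d → ℝ) := {θ | ‖score φ n δ x i θ‖ ≤ γ}

/-- `θ` is a Dantzig selector for the `i`-th row: a minimizer of the `l_1` norm over the
constraint set. -/
def IsDantzigSelector {d : ℕ} (φ : ℕ → ℝ → ℝ) (n : ℕ) (δ γ : ℝ) (x : ℝ≥0 → Fin d → ℝ)
    (i : Fin d) (θ : Fin d → ℝ) : Prop :=
  IsMinOn l1Norm (constraintSet φ n δ γ x i) θ ∧ θ ∈ constraintSet φ n δ γ x i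

/-! ### Matrix factors

They take values in `[0, ∞]`; the infimum over an empty set is `∞`. -/

/-- The cone `C_T = {h : ‖h_{Tᶜ}‖_1 ≤ ‖h_T‖_1}`. -/
def cone {d : ℕ} (T : Finset (Fin d)) : Set (Fin d → ℝ) :=
  {h | ∑ j ∈ Tᶜ, |h j| ≤ ∑ j ∈ T, |h j|}

/-- The quadratic form `hᵀ V h`. -/
def quadForm {d : ℕ} (V : Matrix (Fin d) (Fin d) ℝ) (h : Fin d → ℝ) : ℝ :=
  h ⬝ᵥ V.mulVec h

/-- Compatibility factor. -/
def kappa {d : ℕ} (T : Finset (Fin d)) (V : Matrix (Fin d) (Fin d) ℝ) : ℝ≥0∞ :=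
  ⨅ (h : Fin d → ℝ) (_ : h ≠ 0 ∧ h ∈ cone T),
    ENNReal.ofReal (√(T.card : ℝ) * √(quadForm V h) / ∑ j ∈ T, |h j|)

/-- Weak cone invertibility factor with `q = ∞`. -/
def FInfty {d : ℕ} (T : Finset (Fin d)) (V : Matrix (Fin d) (Fin d) ℝ) : ℝ≥0∞ :=
  ⨅ (h : Fin d → ℝ) (_ : h ≠ 0 ∧ h ∈ cone T), ENNReal.ofReal (√(quadForm V h) / ‖h‖)

/-- Restricted eigenvalue. -/
def RE {d : ℕ} (T : Finset (Fin d)) (V : Matrix (Fin d) (Fin d) ℝ) : ℝ≥0∞ :=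
  ⨅ (h : Fin d → ℝ) (_ : h ≠ 0 ∧ h ∈ cone T), ENNReal.ofReal (√(quadForm V h) / l2Norm h)

/-- With probability arbitrarily close to one, the compatibility factors
`κ(T_0^i, V_n^i)`, `i ≤ p n`, are bounded away from zero uniformly in `i` and all large `n`. -/
def CompatibilityCondition {Ω : Type*} [MeasurableSpace Ω] (P : Measure Ω) (p : ℕ → ℕ)
    (Δ : ℕ → ℝ) (φ : ℕ → ℝ → ℝ) (Θ : ℕ → ℕ → ℝ)
    (X : (n : ℕ) → ℝ≥0 → Ω → Fin (p n) → ℝ) : Prop :=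
  ∀ ε : ℝ, 0 < ε → ∃ δ : ℝ, 0 < δ ∧ ∃ n₀ : ℕ, ∀ n, n₀ ≤ n →
    1 - ENNReal.ofReal ε ≤ P {ω | ENNReal.ofReal δ <
      ⨅ i : Fin (p n), kappa (rowSupport Θ i) (hessian φ n (Δ n) (fun t => X n t ω) i)}

/-- `4 sup_i ‖Θ_i‖_1 γ`, the supremum being over the rows of the `d × d` block. -/
def boundNumerator (Θ : ℕ → ℕ → ℝ) (d : ℕ) (γ : ℝ) : ℝ≥0∞ :=
  4 * (⨆ i : Fin d, ENNReal.ofReal (l1Norm (row Θ i))) * ENNReal.ofReal γ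

end

end SparseDiffusion

namespace SparseDiffusion

/-! ### Independence of increments from the history -/

theorem indep_sup_left_of_indep {Ω : Type*} {A B C mΩ : MeasurableSpace Ω} {μ : Measure Ω}
    [IsProbabilityMeasure μ] (hA : A ≤ mΩ) (hB : B ≤ mΩ) (hC : C ≤ mΩ)
    (hABC : Indep A (B ⊔ C) μ) (hBC : Indep B C μ) : Indep (A ⊔ B) C μ := by
  let p : Set (Set Ω) := Set.image2 (· ∩ ·) {s | MeasurableSet[A] s} {s | MeasurableSet[B] s}
  have hp : IsPiSystem p := by
    rintro _ ⟨a, ha, b, hb, rfl⟩ _ ⟨a', ha', b', hb', rfl⟩ -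
    refine ⟨a ∩ a', MeasurableSet.inter ha ha', b ∩ b', MeasurableSet.inter hb hb', ?_⟩
    exact Set.inter_inter_inter_comm a a' b b'
  have hgen : A ⊔ B = MeasurableSpace.generateFrom p := by
    refine le_antisymm (sup_le ?_ ?_) (MeasurableSpace.generateFrom_le ?_)
    · intro s hs
      exact MeasurableSpace.measurableSet_generateFrom
        ⟨s, hs, Set.univ, MeasurableSet.univ, Set.inter_univ s⟩
    · intro s hs
      exact MeasurableSpace.measurableSet_generateFrom
        ⟨Set.univ, MeasurableSet.univ, s, hs, Set.univ_inter s⟩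
    · rintro _ ⟨a, ha, b, hb, rfl⟩
      exact MeasurableSet.inter ((le_sup_left : A ≤ A ⊔ B) _ ha)
        ((le_sup_right : B ≤ A ⊔ B) _ hb)
  refine IndepSets.indep (sup_le hA hB) hC hp (@MeasurableSpace.isPiSystem_measurableSet Ω C) hgen
    (@MeasurableSpace.generateFrom_measurableSet Ω C).symm ?_
  rw [IndepSets_iff]
  rintro _ c ⟨a, ha, b, hb, rfl⟩ hc
  rw [Indep_iff] at hABC hBC
  have hbc : MeasurableSet[B ⊔ C] (b ∩ c) :=
    MeasurableSet.inter ((le_sup_left : B ≤ B ⊔ C) _ hb) ((le_sup_right : C ≤ B ⊔ C) _ hc)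
  have hb' : MeasurableSet[B ⊔ C] b := (le_sup_left : B ≤ B ⊔ C) _ hb
  change μ (a ∩ b ∩ c) = μ (a ∩ b) * μ c
  rw [Set.inter_assoc, hABC a _ ha hbc, hBC b c hb hc, hABC a b ha hb', mul_assoc]

theorem history_mono {Ω : Type*} (F₀ : MeasurableSpace Ω) (W : ℕ → ℝ≥0 → Ω → ℝ) :
    Monotone (history F₀ W) := by
  intro s t hst
  refine sup_le_sup le_rfl (iSup_mono fun j => iSup_mono fun u => ?_)
  exact iSup_le fun hu => le_iSup_of_le (hu.trans hst) le_rfl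

theorem IsBrownianBasis.history_le {Ω : Type*} {F₀ : MeasurableSpace Ω}
    [mΩ : MeasurableSpace Ω] {P : Measure Ω} {W : ℕ → ℝ≥0 → Ω → ℝ}
    (hW : IsBrownianBasis F₀ P W) (t : ℝ≥0) :
    history F₀ W t ≤ mΩ :=
  sup_le hW.initial_le (iSup_le fun j => iSup_le fun s => iSup_le fun _ => by
    rw [← BorelSpace.measurable_eq (α := ℝ)]
    exact (hW.measurable j s).comap_le)

theorem measurable_history {Ω : Type*} (F₀ : MeasurableSpace Ω) (W : ℕ → ℝ≥0 → Ω → ℝ) (j : ℕ)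
    {s t : ℝ≥0} (hst : s ≤ t) : Measurable[history F₀ W t] (W j s) := by
  refine Measurable.of_comap_le ?_
  rw [BorelSpace.measurable_eq (α := ℝ)]
  refine le_trans ?_ (le_sup_right : _ ≤ history F₀ W t)
  exact le_iSup_of_le j (le_iSup_of_le s (le_iSup_of_le hst le_rfl))

theorem IsBrownianBasis.indep_history_increment {Ω : Type*} {F₀ : MeasurableSpace Ω}
    [mΩ : MeasurableSpace Ω] {P : Measure Ω} [IsProbabilityMeasure P]
    {W : ℕ → ℝ≥0 → Ω → ℝ} (hW : IsBrownianBasis F₀ P W) (i : ℕ)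
    {s t : ℝ≥0} (hst : s ≤ t) :
    Indep (history F₀ W s) (MeasurableSpace.comap (fun ω => W i t ω - W i s ω) inferInstance)
      P := by
  have hborel := BorelSpace.measurable_eq (α := ℝ)
  let G : ℕ → MeasurableSpace Ω := fun j => ⨆ t, MeasurableSpace.comap (W j t) (borel ℝ)
  have hcomap : ∀ j t, MeasurableSpace.comap (W j t) (borel ℝ) ≤ mΩ := fun j t => by
    rw [← hborel]; exact (hW.measurable j t).comap_le
  have hG : ∀ j, G j ≤ mΩ := fun j => iSup_le fun t => hcomap j t
  let B : Set ℕ → MeasurableSpace Ω := fun S => ⨆ j ∈ S, G j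
  let H : ℝ≥0 → MeasurableSpace Ω := fun s =>
    ⨆ (u : ℝ≥0) (_ : u ≤ s), MeasurableSpace.comap (W i u) (borel ℝ)
  let D : ℝ≥0 → MeasurableSpace Ω := fun t =>
    MeasurableSpace.comap (fun ω => W i t ω - W i s ω) inferInstance
  have hB : B {i}ᶜ ≤ mΩ := iSup₂_le fun j _ => hG j
  have hHm : H s ≤ mΩ := iSup₂_le fun u _ => hcomap i u
  have hD : D t ≤ mΩ := ((hW.measurable i t).sub (hW.measurable i s)).comap_le
  have hHsG : H s ≤ G i := iSup₂_le fun u _ =>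
    le_iSup (fun t => MeasurableSpace.comap (W i t) (borel ℝ)) u
  have hWG : ∀ u, Measurable[G i] (W i u) := fun u => by
    refine Measurable.of_comap_le ?_
    rw [hborel]
    exact le_iSup (fun t => MeasurableSpace.comap (W i t) (borel ℝ)) u
  have hDG : D t ≤ G i := Measurable.comap_le (Measurable.sub (hWG t) (hWG s))
  have hHD : Indep (H s) (D t) P := by
    have h := (hW.brownian i).toIsPreBrownianReal.indepFun_shift s
    rw [IndepFun_iff_Indep] at h
    refine indep_of_indep_of_le h.symm ?_ ?_
    · refine iSup₂_le fun u hu => ?_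
      rw [← hborel]
      have : W i u = (fun f : Set.Iic s → ℝ => f ⟨u, hu⟩) ∘ fun ω (v : Set.Iic s) => W i v ω := rfl
      rw [this, ← MeasurableSpace.comap_comp]
      exact MeasurableSpace.comap_mono (measurable_pi_apply _).comap_le
    · have : (fun ω => W i t ω - W i s ω) = (fun f : ℝ≥0 → ℝ => f (t - s)) ∘
          fun ω v => W i (s + v) ω - W i s ω := by
        funext ω; simp [add_tsub_cancel_of_le hst]
      change MeasurableSpace.comap _ _ ≤ _
      rw [this, ← MeasurableSpace.comap_comp]
      exact MeasurableSpace.comap_mono (measurable_pi_apply _).comap_le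
  have hBD : Indep (B {i}ᶜ) (H s ⊔ D t) P := by
    have h := indep_iSup_of_disjoint hG hW.independent (S := {i}ᶜ) (T := {i})
      disjoint_compl_left
    refine indep_of_indep_of_le_right h (sup_le ?_ ?_)
    · simpa using hHsG
    · simpa using hDG
  have h12 : Indep (B {i}ᶜ ⊔ H s) (D t) P := indep_sup_left_of_indep hB hHm hD hBD hHD
  have hall : ∀ j, G j ≤ ⨆ j, G j := le_iSup G
  have h0 : Indep F₀ ((B {i}ᶜ ⊔ H s) ⊔ D t) P :=
    indep_of_indep_of_le_right hW.initial_indep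
      (sup_le (sup_le (iSup₂_le fun j _ => hall j) (hHsG.trans (hall i))) (hDG.trans (hall i)))
  have h := indep_sup_left_of_indep hW.initial_le (sup_le hB hHm) hD h0 h12
  refine indep_of_indep_of_le_left h (sup_le_sup le_rfl (iSup_le fun j => iSup₂_le fun u hu => ?_))
  by_cases hj : j = i
  · subst hj
    exact le_sup_of_le_right (le_iSup₂_of_le u hu le_rfl)
  · refine le_sup_of_le_left (le_iSup₂_of_le j hj ?_)
    exact le_iSup (fun t => MeasurableSpace.comap (W j t) (borel ℝ)) u

/-! ### Exponential moments of sums of innovations -/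

theorem lintegral_prod_innovations_le {Ω : Type*} [mΩ : MeasurableSpace Ω] {P : Measure Ω}
    [IsProbabilityMeasure P] {G : ℕ → MeasurableSpace Ω} (hmono : Monotone G)
    (hG : ∀ k, G k ≤ mΩ) {Y ξ : ℕ → Ω → ℝ} (hY : ∀ k, Measurable[G k] (Y k))
    (hξ : ∀ k, Measurable[G (k + 1)] (ξ k))
    (hind : ∀ k, Indep (G k) (MeasurableSpace.comap (ξ k) inferInstance) P)
    {ψ : ℝ → ℝ → ℝ≥0∞} (hψ : Measurable (Function.uncurry ψ)) {c : ℝ≥0∞}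
    (hc : ∀ k ω, ∫⁻ ω', ψ (Y k ω) (ξ k ω') ∂P ≤ c) (n : ℕ) :
    ∫⁻ ω, ∏ k ∈ Finset.range n, ψ (Y k ω) (ξ k ω) ∂P ≤ c ^ n := by
  induction n with
  | zero => simp
  | succ n ih =>
    let Z : Ω → ℝ≥0∞ := fun ω => ∏ k ∈ Finset.range n, ψ (Y k ω) (ξ k ω)
    have hZ : Measurable[G n] Z := by
      refine Finset.measurable_fun_prod _ fun k hk => ?_
      have hk' : k + 1 ≤ n := Finset.mem_range.1 hk
      exact hψ.comp (Measurable.prodMk ((hY k).mono (hmono (by omega)) le_rfl)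
        ((hξ k).mono (hmono hk') le_rfl))
    have hZY : Measurable[G n] fun ω => (Z ω, Y n ω) := Measurable.prodMk hZ (hY n)
    have hZY' : Measurable fun ω => (Z ω, Y n ω) := hZY.mono (hG n) le_rfl
    have hξ' : Measurable (ξ n) := (hξ n).mono (hG _) le_rfl
    have hI : IndepFun (fun ω => (Z ω, Y n ω)) (ξ n) P := by
      rw [IndepFun_iff_Indep]
      exact indep_of_indep_of_le_left (hind n) hZY.comap_le
    have hmap := (indepFun_iff_map_prod_eq_prod_map_map hZY'.aemeasurable hξ'.aemeasurable).1 hI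
    have hF : Measurable fun q : (ℝ≥0∞ × ℝ) × ℝ => q.1.1 * ψ q.1.2 q.2 :=
      (measurable_fst.comp measurable_fst).mul
        (hψ.comp ((measurable_snd.comp measurable_fst).prodMk measurable_snd))
    have : IsProbabilityMeasure (P.map (ξ n)) := Measure.isProbabilityMeasure_map hξ'.aemeasurable
    calc ∫⁻ ω, ∏ k ∈ Finset.range (n + 1), ψ (Y k ω) (ξ k ω) ∂P
        = ∫⁻ ω, Z ω * ψ (Y n ω) (ξ n ω) ∂P := by simp_rw [Finset.prod_range_succ]; rfl
      _ = ∫⁻ q, q.1.1 * ψ q.1.2 q.2 ∂(P.map fun ω => ((Z ω, Y n ω), ξ n ω)) := by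
        rw [lintegral_map hF (hZY'.prodMk hξ')]
      _ = ∫⁻ a, ∫⁻ x, a.1 * ψ a.2 x ∂(P.map (ξ n)) ∂(P.map fun ω => (Z ω, Y n ω)) := by
        rw [hmap, lintegral_prod _ hF.aemeasurable]
      _ = ∫⁻ ω, Z ω * ∫⁻ ω', ψ (Y n ω) (ξ n ω') ∂P ∂P := by
        rw [lintegral_map hF.lintegral_prod_right' hZY']
        refine lintegral_congr fun ω => ?_
        have hψ' : Measurable fun x => ψ (Y n ω) x :=
          hψ.comp (measurable_const.prodMk measurable_id)
        rw [lintegral_const_mul _ hψ', lintegral_map hψ' hξ']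
      _ ≤ ∫⁻ ω, Z ω * c ∂P := lintegral_mono fun ω => mul_le_mul_right (hc n ω) _
      _ = (∫⁻ ω, Z ω ∂P) * c := lintegral_mul_const _ (hZ.mono (hG n) le_rfl)
      _ ≤ c ^ (n + 1) := by rw [pow_succ]; exact mul_le_mul_left ih _

theorem lintegral_exp_mul_gaussianReal (v : ℝ≥0) (a : ℝ) :
    ∫⁻ x, ENNReal.ofReal (Real.exp (a * x)) ∂(gaussianReal 0 v)
      = ENNReal.ofReal (Real.exp (a ^ 2 * v / 2)) := by
  rw [← ofReal_integral_eq_lintegral_ofReal (integrable_exp_mul_gaussianReal a)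
    (ae_of_all _ fun x => (Real.exp_pos _).le)]
  have := congrFun (mgf_id_gaussianReal (μ := 0) (v := v)) a
  rw [mgf] at this
  simp only [id] at this
  rw [this]
  congr 2
  ring

/-- `E exp (-ξ²)` for a standard normal variable `ξ`. -/
noncomputable def gaussianSqLaplace : ℝ≥0∞ :=
  ∫⁻ x, ENNReal.ofReal (Real.exp (-x ^ 2)) ∂(gaussianReal 0 1)

theorem gaussianSqLaplace_lt_one : gaussianSqLaplace < 1 := by
  have hlt : gaussianSqLaplace < ∫⁻ _, 1 ∂(gaussianReal 0 1) := by
    have : NullSingletonClass (gaussianReal 0 1) := nullSingletonClass_gaussianReal one_ne_zero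
    refine lintegral_strict_mono (IsProbabilityMeasure.ne_zero _) (by fun_prop) ?_ ?_
    · refine ne_top_of_le_ne_top (b := ∫⁻ _, 1 ∂(gaussianReal 0 1)) (by simp)
        (lintegral_mono fun x => ?_)
      rw [ENNReal.ofReal_le_one, Real.exp_le_one_iff]
      nlinarith [sq_nonneg x]
    · have h0 : ∀ᵐ x ∂(gaussianReal 0 1), x ≠ (0 : ℝ) := by
        rw [ae_iff]
        simp
      filter_upwards [h0] with x hx
      rw [ENNReal.ofReal_lt_one, Real.exp_lt_one_iff]
      have := sq_pos_of_ne_zero hx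
      linarith
  simpa using hlt

theorem lintegral_exp_neg_sq_gaussianReal {v : ℝ≥0} (hv : v ≠ 0) :
    ∫⁻ x, ENNReal.ofReal (Real.exp (-(x ^ 2 / v))) ∂(gaussianReal 0 v) = gaussianSqLaplace := by
  have hmap : (gaussianReal 0 1).map (√(v : ℝ) * ·) = gaussianReal 0 v := by
    rw [gaussianReal_map_const_mul]
    congr 1
    · simp
    · ext; simp
  rw [← hmap, lintegral_map (by fun_prop) (by fun_prop), gaussianSqLaplace]
  refine lintegral_congr fun x => ?_
  have hv' : (v : ℝ) ≠ 0 := by exact_mod_cast hv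
  rw [mul_pow, Real.sq_sqrt (NNReal.coe_nonneg v), mul_div_cancel_left₀ _ hv']

/-! ### Tail bounds on an equidistant grid -/

/-- The `k`-th observation time `k δ`. -/
noncomputable def gridTime (δ : ℝ) (k : ℕ) : ℝ≥0 := (k * δ).toNNReal

theorem coe_gridTime {δ : ℝ} (hδ : 0 ≤ δ) (k : ℕ) : (gridTime δ k : ℝ) = k * δ :=
  Real.coe_toNNReal _ (by positivity)

theorem gridTime_mono {δ : ℝ} (hδ : 0 ≤ δ) : Monotone (gridTime δ) := fun k l hkl =>
  Real.toNNReal_le_toNNReal (mul_le_mul_of_nonneg_right (by exact_mod_cast hkl) hδ)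

theorem measure_ge_le_exp_neg_mul {Ω : Type*} [MeasurableSpace Ω] {P : Measure Ω} {f : Ω → ℝ}
    (hf : AEMeasurable f P) (a : ℝ) {c : ℝ≥0∞}
    (hc : ∫⁻ ω, ENNReal.ofReal (Real.exp (f ω)) ∂P ≤ c) :
    P {ω | a ≤ f ω} ≤ ENNReal.ofReal (Real.exp (-a)) * c := by
  have hpos : ENNReal.ofReal (Real.exp a) ≠ 0 := by simp [Real.exp_pos]
  have h := meas_ge_le_lintegral_div (μ := P) (f := fun ω => ENNReal.ofReal (Real.exp (f ω)))
    (hf.exp.ennreal_ofReal) hpos ENNReal.ofReal_ne_top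
  calc P {ω | a ≤ f ω}
      = P {ω | ENNReal.ofReal (Real.exp a) ≤ ENNReal.ofReal (Real.exp (f ω))} := by
        congr 1; ext ω
        simp [ENNReal.ofReal_le_ofReal_iff (Real.exp_pos _).le]
    _ ≤ (∫⁻ ω, ENNReal.ofReal (Real.exp (f ω)) ∂P) / ENNReal.ofReal (Real.exp a) := h
    _ ≤ c / ENNReal.ofReal (Real.exp a) := ENNReal.div_le_div_right hc _
    _ = ENNReal.ofReal (Real.exp (-a)) * c := by
        rw [div_eq_mul_inv, mul_comm, Real.exp_neg, ENNReal.ofReal_inv_of_pos (Real.exp_pos _)]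

theorem map_sub_of_isPreBrownianReal {Ω : Type*} [MeasurableSpace Ω] {P : Measure Ω}
    {B : ℝ≥0 → Ω → ℝ} (hB : IsPreBrownianReal B P) {s t : ℝ≥0} (hst : s ≤ t) :
    P.map (fun ω => B t ω - B s ω) = gaussianReal 0 (t - s) := by
  have h := (hB.hasLaw_sub t s).map_eq
  have hd : nndist (t : ℝ) (s : ℝ) = t - s := by
    ext
    rw [coe_nndist, Real.dist_eq, NNReal.coe_sub hst, abs_of_nonneg (by simpa using hst)]
  change P.map (B t - B s) = _
  rw [h]
  congr 1

section Basis

variable {Ω : Type*} {F₀ : MeasurableSpace Ω} [mΩ : MeasurableSpace Ω] {P : Measure Ω}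
  {W : ℕ → ℝ≥0 → Ω → ℝ}

theorem IsBrownianBasis.lintegral_increment (hW : IsBrownianBasis F₀ P W) (i : ℕ) {s t : ℝ≥0}
    (hst : s ≤ t) {f : ℝ → ℝ≥0∞} (hf : Measurable f) :
    ∫⁻ ω, f (W i t ω - W i s ω) ∂P = ∫⁻ x, f x ∂(gaussianReal 0 (t - s)) := by
  rw [← map_sub_of_isPreBrownianReal (hW.brownian i).toIsPreBrownianReal hst,
    lintegral_map hf (by exact (hW.measurable i t).sub (hW.measurable i s))]

theorem gridTime_succ_sub {δ : ℝ} (hδ : 0 ≤ δ) (k : ℕ) :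
    gridTime δ (k + 1) - gridTime δ k = δ.toNNReal := by
  ext
  rw [NNReal.coe_sub (gridTime_mono hδ k.le_succ), coe_gridTime hδ, coe_gridTime hδ,
    Real.coe_toNNReal _ hδ]
  push_cast; ring

variable [IsProbabilityMeasure P]

theorem IsBrownianBasis.lintegral_prod_increments_le (hW : IsBrownianBasis F₀ P W) (i : ℕ)
    {δ : ℝ} (hδ : 0 ≤ δ) {Y : ℕ → Ω → ℝ}
    (hY : ∀ k, Measurable[history F₀ W (gridTime δ k)] (Y k)) {ψ : ℝ → ℝ → ℝ≥0∞}
    (hψ : Measurable (Function.uncurry ψ)) {c : ℝ≥0∞}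
    (hc : ∀ k ω, ∫⁻ x, ψ (Y k ω) x ∂(gaussianReal 0 δ.toNNReal) ≤ c) (n : ℕ) :
    ∫⁻ ω, ∏ k ∈ Finset.range n,
      ψ (Y k ω) (W i (gridTime δ (k + 1)) ω - W i (gridTime δ k) ω) ∂P ≤ c ^ n := by
  have hmono := gridTime_mono hδ
  refine lintegral_prod_innovations_le (G := fun k => history F₀ W (gridTime δ k))
    ((history_mono F₀ W).comp hmono) (fun k => hW.history_le _) hY ?_ ?_ hψ ?_ n
  · intro k
    exact Measurable.sub (measurable_history F₀ W i le_rfl)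
      (measurable_history F₀ W i (hmono k.le_succ))
  · exact fun k => hW.indep_history_increment i (hmono k.le_succ)
  · intro k ω
    rw [hW.lintegral_increment i (hmono k.le_succ)
      (f := fun x => ψ (Y k ω) x) (hψ.comp (measurable_const.prodMk measurable_id)),
      gridTime_succ_sub hδ]
    exact hc k ω

/-- Sub-Gaussian upper tail of a stochastic integral over a grid with bounded integrand. -/
theorem IsBrownianBasis.measure_le_sum_mul_increment_le (hW : IsBrownianBasis F₀ P W) (i : ℕ)
    {δ : ℝ} (hδ : 0 < δ) {Y : ℕ → Ω → ℝ}
    (hY : ∀ k, Measurable[history F₀ W (gridTime δ k)] (Y k)) {L : ℝ} (hL : 0 < L)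
    (hYL : ∀ k ω, |Y k ω| ≤ L) {n : ℕ} (hn : 1 ≤ n) {a : ℝ} (ha : 0 < a) :
    P {ω | a ≤ ∑ k ∈ Finset.range n,
        Y k ω * (W i (gridTime δ (k + 1)) ω - W i (gridTime δ k) ω)}
      ≤ ENNReal.ofReal (Real.exp (-(a ^ 2 / (2 * L ^ 2 * (n * δ))))) := by
  have hn0 : (0 : ℝ) < n := by exact_mod_cast hn
  set b : ℝ := a / (L ^ 2 * (n * δ)) with hb
  have hbpos : 0 < b := by positivity
  have hYm : ∀ k, Measurable (Y k) := fun k => (hY k).mono (hW.history_le _) le_rfl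
  have hmeas : Measurable fun ω => b * ∑ k ∈ Finset.range n,
      Y k ω * (W i (gridTime δ (k + 1)) ω - W i (gridTime δ k) ω) :=
    (Finset.measurable_fun_sum _ fun k _ =>
      (hYm k).mul ((hW.measurable i _).sub (hW.measurable i _))).const_mul b
  have hexp := hW.lintegral_prod_increments_le i hδ.le hY
    (ψ := fun y x => ENNReal.ofReal (Real.exp (b * y * x)))
    (c := ENNReal.ofReal (Real.exp (b ^ 2 * L ^ 2 * δ / 2)))
    (by fun_prop) (fun k ω => by
      rw [lintegral_exp_mul_gaussianReal, Real.coe_toNNReal _ hδ.le]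
      refine ENNReal.ofReal_le_ofReal (Real.exp_le_exp.2 ?_)
      have : Y k ω ^ 2 ≤ L ^ 2 := sq_le_sq' (abs_le.1 (hYL k ω)).1 (abs_le.1 (hYL k ω)).2
      rw [mul_pow]
      gcongr) n
  have hprod : ∀ ω, ∏ k ∈ Finset.range n, ENNReal.ofReal (Real.exp (b * Y k ω *
      (W i (gridTime δ (k + 1)) ω - W i (gridTime δ k) ω)))
      = ENNReal.ofReal (Real.exp (b * ∑ k ∈ Finset.range n,
      Y k ω * (W i (gridTime δ (k + 1)) ω - W i (gridTime δ k) ω))) := by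
    intro ω
    rw [← ENNReal.ofReal_prod_of_nonneg (fun _ _ => (Real.exp_pos _).le), ← Real.exp_sum,
      Finset.mul_sum]
    simp_rw [mul_assoc]
  simp_rw [hprod] at hexp
  have h := measure_ge_le_exp_neg_mul hmeas.aemeasurable (b * a) hexp
  calc P _ = P {ω | b * a ≤ b * ∑ k ∈ Finset.range n,
        Y k ω * (W i (gridTime δ (k + 1)) ω - W i (gridTime δ k) ω)} := by
        simp_rw [mul_le_mul_iff_right₀ hbpos]
    _ ≤ _ := h
    _ = _ := by
      rw [← ENNReal.ofReal_pow (Real.exp_pos _).le, ← Real.exp_nat_mul,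
        ← ENNReal.ofReal_mul (Real.exp_pos _).le, ← Real.exp_add, hb]
      congr 2
      field_simp
      ring

theorem IsBrownianBasis.measure_le_abs_sum_mul_increment_le (hW : IsBrownianBasis F₀ P W) (i : ℕ)
    {δ : ℝ} (hδ : 0 < δ) {Y : ℕ → Ω → ℝ}
    (hY : ∀ k, Measurable[history F₀ W (gridTime δ k)] (Y k)) {L : ℝ} (hL : 0 < L)
    (hYL : ∀ k ω, |Y k ω| ≤ L) {n : ℕ} (hn : 1 ≤ n) {a : ℝ} (ha : 0 < a) :
    P {ω | a ≤ |∑ k ∈ Finset.range n,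
        Y k ω * (W i (gridTime δ (k + 1)) ω - W i (gridTime δ k) ω)|}
      ≤ 2 * ENNReal.ofReal (Real.exp (-(a ^ 2 / (2 * L ^ 2 * (n * δ))))) := by
  have h₁ := hW.measure_le_sum_mul_increment_le i hδ hY hL hYL hn ha
  have h₂ := hW.measure_le_sum_mul_increment_le i hδ (Y := fun k ω => -Y k ω)
    (fun k => (hY k).neg) hL (fun k ω => by rw [abs_neg]; exact hYL k ω) hn ha
  rw [two_mul]
  refine le_trans (measure_mono ?_) ((measure_union_le _ _).trans (add_le_add h₁ h₂))
  intro ω hω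
  rcases le_abs.1 (Set.mem_ofPred_eq ▸ hω) with h | h
  · exact Or.inl h
  · right
    simpa [Finset.sum_neg_distrib] using h

/-- Lower tail of the realized quadratic variation of a Brownian motion. -/
theorem IsBrownianBasis.measure_sum_sq_increment_le (hW : IsBrownianBasis F₀ P W) (i : ℕ)
    {δ : ℝ} (hδ : 0 < δ) (n : ℕ) (a : ℝ) :
    P {ω | ∑ k ∈ Finset.range n,
        (W i (gridTime δ (k + 1)) ω - W i (gridTime δ k) ω) ^ 2 ≤ a * (n * δ)}
      ≤ ENNReal.ofReal (Real.exp (n * a)) * gaussianSqLaplace ^ n := by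
  have hδ' : δ.toNNReal ≠ 0 := by simpa using hδ
  have hexp := hW.lintegral_prod_increments_le i hδ.le (Y := fun _ _ => 0)
    (fun k => measurable_const)
    (ψ := fun _ x => ENNReal.ofReal (Real.exp (-(x ^ 2 / δ.toNNReal))))
    (c := gaussianSqLaplace) (by fun_prop)
    (fun k ω => (lintegral_exp_neg_sq_gaussianReal hδ').le) n
  have hprod : ∀ ω, ∏ k ∈ Finset.range n, ENNReal.ofReal (Real.exp (-(
      (W i (gridTime δ (k + 1)) ω - W i (gridTime δ k) ω) ^ 2 / δ.toNNReal)))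
      = ENNReal.ofReal (Real.exp (-((∑ k ∈ Finset.range n,
      (W i (gridTime δ (k + 1)) ω - W i (gridTime δ k) ω) ^ 2) / δ))) := by
    intro ω
    rw [← ENNReal.ofReal_prod_of_nonneg (fun _ _ => (Real.exp_pos _).le), ← Real.exp_sum,
      Finset.sum_neg_distrib, Finset.sum_div, Real.coe_toNNReal _ hδ.le]
  simp_rw [hprod] at hexp
  have hmeas : Measurable fun ω => -((∑ k ∈ Finset.range n,
      (W i (gridTime δ (k + 1)) ω - W i (gridTime δ k) ω) ^ 2) / δ) :=
    ((Finset.measurable_fun_sum _ fun k _ =>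
      ((hW.measurable i _).sub (hW.measurable i _)).pow_const 2).div_const δ).neg
  have h := measure_ge_le_exp_neg_mul hmeas.aemeasurable (-(n * a)) hexp
  rw [neg_neg] at h
  refine le_trans (measure_mono fun ω hω => ?_) h
  simp only [Set.mem_ofPred_eq] at hω ⊢
  rw [neg_le_neg_iff, div_le_iff₀ hδ]
  linarith

end Basis

/-! ### Time averages of the oscillation of a Brownian motion -/

/-- A process with almost surely continuous paths agrees, off a null set, with a process all of
whose paths are continuous. -/
theorem exists_continuous_modification {Ω : Type*} [MeasurableSpace Ω] {P : Measure Ω}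
    {B : ℝ≥0 → Ω → ℝ} (hm : ∀ t, Measurable (B t)) (hc : ∀ᵐ ω ∂P, Continuous fun t => B t ω) :
    ∃ B' : ℝ≥0 → Ω → ℝ, (∀ t, Measurable (B' t)) ∧ (∀ ω, Continuous fun t => B' t ω) ∧
      ∀ᵐ ω ∂P, Continuous (fun t => B t ω) ∧ ∀ t, B' t ω = B t ω := by
  classical
  let s : Set Ω := toMeasurable P {ω | Continuous fun t => B t ω}ᶜ
  have hs : P s = 0 := by
    rw [measure_toMeasurable]; exact hc
  have hsm : MeasurableSet s := measurableSet_toMeasurable _ _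
  have hsc : ∀ ω, ω ∉ s → Continuous fun t => B t ω := fun ω hω => by
    by_contra hns
    exact hω (subset_toMeasurable P _ hns)
  refine ⟨fun t => sᶜ.indicator (B t), fun t => (hm t).indicator hsm.compl, fun ω => ?_, ?_⟩
  · by_cases hω : ω ∈ s
    · simpa [hω] using continuous_const
    · simpa [hω] using hsc ω hω
  · have : ∀ᵐ ω ∂P, ω ∉ s := measure_eq_zero_iff_ae_notMem.1 hs
    filter_upwards [this] with ω hω
    exact ⟨hsc ω hω, fun t => by simp [hω]⟩

/-- The accumulated oscillation of a path between consecutive grid points. -/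
noncomputable def gridOscillation (δ : ℝ) (n : ℕ) (w : ℝ≥0 → ℝ) : ℝ :=
  ∑ k ∈ Finset.range n, ∫ s in (k * δ)..((k + 1) * δ), |w s.toNNReal - w (gridTime δ k)|

theorem exp_mul_le_of_gridOscillation {δ : ℝ} (hδ : 0 < δ) (n : ℕ) {w : ℝ≥0 → ℝ}
    (hw : Continuous w) {a : ℝ} (ha : a * √δ * (n * δ) ≤ gridOscillation δ n w) :
    Real.exp a * (n * δ) ≤ ∑ k ∈ Finset.range n, ∫ s in (k * δ)..((k + 1) * δ),
      Real.exp (|w s.toNNReal - w (gridTime δ k)| / √δ) := by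
  have hsq : 0 < √δ := Real.sqrt_pos.2 hδ
  have hws : Continuous fun s : ℝ => w s.toNNReal := hw.comp continuous_real_toNNReal
  have key : gridOscillation δ n w / √δ ≤ (n * δ) * (a - 1) + Real.exp (-a) *
      ∑ k ∈ Finset.range n, ∫ s in (k * δ)..((k + 1) * δ),
        Real.exp (|w s.toNNReal - w (gridTime δ k)| / √δ) := by
    have hk : ∀ k ∈ Finset.range n,
        (∫ s in (k * δ)..((k + 1) * δ), |w s.toNNReal - w (gridTime δ k)|) / √δ ≤
        δ * (a - 1) + Real.exp (-a) * ∫ s in (k * δ)..((k + 1) * δ),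
          Real.exp (|w s.toNNReal - w (gridTime δ k)| / √δ) := by
      intro k _
      have hle : (k : ℝ) * δ ≤ (k + 1) * δ := by nlinarith
      have hi : IntervalIntegrable (fun s => Real.exp (|w s.toNNReal - w (gridTime δ k)| / √δ))
          volume (k * δ) ((k + 1) * δ) := Continuous.intervalIntegrable (by fun_prop) _ _
      have hi' : IntervalIntegrable (fun s => |w s.toNNReal - w (gridTime δ k)| / √δ)
          volume (k * δ) ((k + 1) * δ) := Continuous.intervalIntegrable (by fun_prop) _ _
      rw [← intervalIntegral.integral_div]
      calc _ ≤ ∫ s in (k * δ)..((k + 1) * δ), ((a - 1) +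
            Real.exp (-a) * Real.exp (|w s.toNNReal - w (gridTime δ k)| / √δ)) := by
            refine intervalIntegral.integral_mono_on hle hi'
              (intervalIntegrable_const.add (hi.const_mul _)) fun s _ => ?_
            rw [← Real.exp_add]
            linarith [Real.add_one_le_exp (-a + |w s.toNNReal - w (gridTime δ k)| / √δ)]
        _ = _ := by
            rw [intervalIntegral.integral_add intervalIntegrable_const (hi.const_mul _),
              intervalIntegral.integral_const, intervalIntegral.integral_const_mul, smul_eq_mul]
            ring
    rw [gridOscillation, Finset.sum_div]
    refine (Finset.sum_le_sum hk).trans_eq ?_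
    rw [Finset.sum_add_distrib, Finset.mul_sum]
    simp; ring
  have h1 : a * (n * δ) ≤ gridOscillation δ n w / √δ := by
    rw [le_div_iff₀ hsq]; linarith
  have h2 : (n : ℝ) * δ ≤ Real.exp (-a) * ∑ k ∈ Finset.range n,
      ∫ s in (k * δ)..((k + 1) * δ), Real.exp (|w s.toNNReal - w (gridTime δ k)| / √δ) := by
    linarith
  calc Real.exp a * (n * δ) ≤ Real.exp a * (Real.exp (-a) * _) :=
        mul_le_mul_of_nonneg_left h2 (Real.exp_pos a).le
    _ = _ := by rw [← mul_assoc, ← Real.exp_add]; simp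

theorem lintegral_exp_abs_gaussianReal_le (v : ℝ≥0) (b : ℝ) :
    ∫⁻ x, ENNReal.ofReal (Real.exp (|x| * b)) ∂(gaussianReal 0 v)
      ≤ 2 * ENNReal.ofReal (Real.exp (b ^ 2 * v / 2)) := by
  calc ∫⁻ x, ENNReal.ofReal (Real.exp (|x| * b)) ∂(gaussianReal 0 v)
      ≤ ∫⁻ x, (ENNReal.ofReal (Real.exp (b * x)) + ENNReal.ofReal (Real.exp (-b * x)))
          ∂(gaussianReal 0 v) := by
        refine lintegral_mono fun x => ?_
        rcases abs_choice x with h | h <;> rw [h]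
        · rw [mul_comm x b]; exact le_self_add
        · rw [show -x * b = -b * x by ring]; exact le_add_self
    _ = _ := by
        rw [lintegral_add_left (by fun_prop), lintegral_exp_mul_gaussianReal,
          lintegral_exp_mul_gaussianReal, neg_sq, two_mul]

theorem IsBrownianBasis.measure_le_gridOscillation_le {Ω : Type*} {F₀ : MeasurableSpace Ω}
    [mΩ : MeasurableSpace Ω] {P : Measure Ω} [IsProbabilityMeasure P] {W : ℕ → ℝ≥0 → Ω → ℝ}
    (hW : IsBrownianBasis F₀ P W) (i : ℕ) {δ : ℝ} (hδ : 0 < δ) {n : ℕ} (hn : 1 ≤ n) (a : ℝ) :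
    P {ω | a * √δ * (n * δ) ≤ gridOscillation δ n fun t => W i t ω}
      ≤ 2 * ENNReal.ofReal (Real.exp (1 / 2)) * ENNReal.ofReal (Real.exp (-a)) := by
  have hn0 : (0 : ℝ) < n := by exact_mod_cast hn
  have hsq : 0 < √δ := Real.sqrt_pos.2 hδ
  obtain ⟨B, hBm, hBc, hBW⟩ := exists_continuous_modification (hW.measurable i)
    (hW.brownian i).cont
  have hjoint : Measurable fun q : ℝ × Ω => B q.1.toNNReal q.2 :=
    (measurable_uncurry_of_continuous_of_measurable hBc hBm).comp
      ((measurable_real_toNNReal.comp measurable_fst).prodMk measurable_snd)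
  let g : ℕ → ℝ → Ω → ℝ≥0∞ := fun k s ω =>
    ENNReal.ofReal (Real.exp (|B s.toNNReal ω - B (gridTime δ k) ω| / √δ))
  have hg : ∀ k, Measurable (Function.uncurry (g k)) := fun k => by
    have h2 : Measurable fun q : ℝ × Ω => B (gridTime δ k) q.2 := (hBm _).comp measurable_snd
    have h3 : Measurable fun q : ℝ × Ω => |B q.1.toNNReal q.2 - B (gridTime δ k) q.2| :=
      (hjoint.sub h2).abs
    exact (h3.div_const _).exp.ennreal_ofReal
  let f : Ω → ℝ≥0∞ := fun ω => ∑ k ∈ Finset.range n,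
    ∫⁻ s in Set.Ioc (k * δ) ((k + 1) * δ), g k s ω
  have hfm : ∀ k : ℕ, Measurable fun ω => ∫⁻ s in Set.Ioc ((k : ℝ) * δ) ((k + 1) * δ), g k s ω :=
    fun k => (hg k).lintegral_prod_left'
  have hf : Measurable f := Finset.measurable_fun_sum _ fun k _ => hfm k
  set K : ℝ≥0∞ := 2 * ENNReal.ofReal (Real.exp (1 / 2)) with hK
  have hgs : ∀ k : ℕ, ∀ s ∈ Set.Ioc ((k : ℝ) * δ) ((k + 1) * δ), ∫⁻ ω, g k s ω ∂P ≤ K := by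
    intro k s hs
    have hks : gridTime δ k ≤ s.toNNReal := Real.toNNReal_le_toNNReal hs.1.le
    have hcongr : ∫⁻ ω, g k s ω ∂P = ∫⁻ ω, ENNReal.ofReal
        (Real.exp (|W i s.toNNReal ω - W i (gridTime δ k) ω| * (√δ)⁻¹)) ∂P := by
      refine lintegral_congr_ae ?_
      filter_upwards [hBW] with ω hω
      simp only [g, hω.2, div_eq_mul_inv]
    rw [hcongr, hW.lintegral_increment i hks
      (f := fun x => ENNReal.ofReal (Real.exp (|x| * (√δ)⁻¹))) (by fun_prop)]
    refine (lintegral_exp_abs_gaussianReal_le _ _).trans ?_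
    rw [hK]
    gcongr
    have hs0 : 0 ≤ s := le_trans (by positivity) hs.1.le
    rw [NNReal.coe_sub hks, coe_gridTime hδ.le, Real.coe_toNNReal _ hs0, inv_pow,
      Real.sq_sqrt hδ.le, inv_mul_le_iff₀ hδ]
    linarith [hs.2]
  have hEf : ∫⁻ ω, f ω ∂P ≤ ENNReal.ofReal (n * δ) * K := by
    rw [lintegral_finsetSum _ fun k _ => hfm k]
    calc ∑ k ∈ Finset.range n, ∫⁻ ω, (∫⁻ s in Set.Ioc ((k : ℝ) * δ) ((k + 1) * δ), g k s ω) ∂P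
        = ∑ k ∈ Finset.range n, ∫⁻ s in Set.Ioc ((k : ℝ) * δ) ((k + 1) * δ), ∫⁻ ω, g k s ω ∂P := by
          refine Finset.sum_congr rfl fun k _ => ?_
          rw [lintegral_lintegral_swap (f := fun ω s => g k s ω)
            ((hg k).comp measurable_swap).aemeasurable]
      _ ≤ ∑ k ∈ Finset.range n, ∫⁻ s in Set.Ioc ((k : ℝ) * δ) ((k + 1) * δ), K :=
          Finset.sum_le_sum fun k _ => setLIntegral_mono measurable_const (hgs k)
      _ = ENNReal.ofReal (n * δ) * K := by
          simp only [lintegral_const, Measure.restrict_apply_univ, Real.volume_Ioc]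
          have : ∀ k : ℕ, ((k : ℝ) + 1) * δ - k * δ = δ := fun k => by ring
          simp only [this, Finset.sum_const, Finset.card_range, nsmul_eq_mul]
          rw [ENNReal.ofReal_mul hn0.le, ENNReal.ofReal_natCast]
          ring
  have hc0 : ENNReal.ofReal (Real.exp a * (n * δ)) ≠ 0 := by
    simp only [ne_eq, ENNReal.ofReal_eq_zero, not_le]; positivity
  have hmarkov := meas_ge_le_lintegral_div (μ := P) hf.aemeasurable hc0 ENNReal.ofReal_ne_top
  have hsub : P {ω | a * √δ * (n * δ) ≤ gridOscillation δ n fun t => W i t ω}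
      ≤ P {ω | ENNReal.ofReal (Real.exp a * (n * δ)) ≤ f ω} := by
    refine measure_mono_ae ?_
    filter_upwards [hBW] with ω hω h
    have h' := exp_mul_le_of_gridOscillation hδ n hω.1 h
    change _ ≤ f ω
    refine (ENNReal.ofReal_le_ofReal h').trans_eq ?_
    rw [ENNReal.ofReal_sum_of_nonneg fun k _ => intervalIntegral.integral_nonneg (by nlinarith)
      fun s _ => (Real.exp_pos _).le]
    refine Finset.sum_congr rfl fun k _ => ?_
    have hle : (k : ℝ) * δ ≤ (k + 1) * δ := by nlinarith
    have hcont : Continuous fun s : ℝ => Real.exp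
        (|W i s.toNNReal ω - W i (gridTime δ k) ω| / √δ) := by
      have : Continuous fun s : ℝ => W i s.toNNReal ω := hω.1.comp continuous_real_toNNReal
      exact ((this.sub continuous_const).abs.div_const _).rexp
    rw [intervalIntegral.integral_of_le hle, ofReal_integral_eq_lintegral_ofReal
      (hcont.integrableOn_Ioc) (ae_of_all _ fun s => (Real.exp_pos _).le)]
    simp only [g, hω.2]
  refine hsub.trans (hmarkov.trans ?_)
  calc _ ≤ ENNReal.ofReal (n * δ) * K / ENNReal.ofReal (Real.exp a * (n * δ)) :=
        ENNReal.div_le_div_right hEf _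
    _ = K * (ENNReal.ofReal (n * δ) / ENNReal.ofReal (Real.exp a * (n * δ))) := by
        rw [mul_comm, mul_div_assoc]
    _ = K * ENNReal.ofReal (Real.exp (-a)) := by
        rw [← ENNReal.ofReal_div_of_pos (by positivity), Real.exp_neg]
        congr 2
        field_simp

/-! ### Deterministic properties of Dantzig selectors -/

section Norms

variable {d : ℕ}

theorem l1Norm_nonneg (v : Fin d → ℝ) : 0 ≤ l1Norm v := Finset.sum_nonneg fun _ _ => abs_nonneg _

theorem l1Norm_sub_le (v w : Fin d → ℝ) : l1Norm (v - w) ≤ l1Norm v + l1Norm w := by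
  rw [l1Norm, l1Norm, l1Norm, ← Finset.sum_add_distrib]
  exact Finset.sum_le_sum fun j _ => abs_sub (v j) (w j)

theorem norm_le_l1Norm (v : Fin d → ℝ) : ‖v‖ ≤ l1Norm v :=
  (pi_norm_le_iff_of_nonneg (l1Norm_nonneg v)).2 fun j =>
    Finset.single_le_sum (f := fun j => |v j|) (fun _ _ => abs_nonneg _) (Finset.mem_univ j)

theorem l2Norm_le_l1Norm (v : Fin d → ℝ) : l2Norm v ≤ l1Norm v := by
  refine Real.sqrt_le_iff.2 ⟨l1Norm_nonneg v, ?_⟩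
  have h := Finset.sum_sq_le_sq_sum_of_nonneg (s := Finset.univ) (f := fun j => |v j|)
    (fun _ _ => abs_nonneg _)
  simpa [l1Norm] using h

theorem l2Norm_pos {v : Fin d → ℝ} (hv : v ≠ 0) : 0 < l2Norm v := by
  obtain ⟨j, hj⟩ := Function.ne_iff.1 hv
  refine Real.sqrt_pos.2 (Finset.sum_pos' (fun _ _ => sq_nonneg _) ⟨j, Finset.mem_univ j, ?_⟩)
  exact sq_pos_of_ne_zero hj

theorem l1Norm_le_two_mul_of_mem_cone {T : Finset (Fin d)} {h : Fin d → ℝ} (hh : h ∈ cone T) :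
    l1Norm h ≤ 2 * ∑ j ∈ T, |h j| := by
  have h' : ∑ j ∈ Tᶜ, |h j| ≤ ∑ j ∈ T, |h j| := hh
  rw [l1Norm, ← Finset.sum_add_sum_compl T]
  linarith

theorem sub_mem_cone {θ θ' : Fin d → ℝ} {T : Finset (Fin d)} (hT : ∀ j ∉ T, θ j = 0)
    (h : l1Norm θ' ≤ l1Norm θ) : θ' - θ ∈ cone T := by
  have h1 : ∑ j ∈ Tᶜ, |(θ' - θ) j| = ∑ j ∈ Tᶜ, |θ' j| :=
    Finset.sum_congr rfl fun j hj => by simp [hT j (Finset.mem_compl.1 hj)]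
  have h2 : l1Norm θ = ∑ j ∈ T, |θ j| := by
    rw [l1Norm, ← Finset.sum_add_sum_compl T, add_eq_left]
    exact Finset.sum_eq_zero fun j hj => by simp [hT j (Finset.mem_compl.1 hj)]
  have h3 : l1Norm θ' = ∑ j ∈ T, |θ' j| + ∑ j ∈ Tᶜ, |θ' j| :=
    (Finset.sum_add_sum_compl T _).symm
  have h4 : ∑ j ∈ T, |θ j| - ∑ j ∈ T, |θ' j| ≤ ∑ j ∈ T, |(θ' - θ) j| := by
    rw [← Finset.sum_sub_distrib]
    refine Finset.sum_le_sum fun j _ => ?_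
    rw [Pi.sub_apply, abs_sub_comm]
    exact abs_sub_abs_le_abs_sub _ _
  change ∑ j ∈ Tᶜ, |(θ' - θ) j| ≤ ∑ j ∈ T, |(θ' - θ) j|
  linarith

theorem quadForm_le (V : Matrix (Fin d) (Fin d) ℝ) (h : Fin d → ℝ) :
    quadForm V h ≤ l1Norm h * ‖V.mulVec h‖ := by
  rw [quadForm, dotProduct, l1Norm, Finset.sum_mul]
  refine Finset.sum_le_sum fun j _ => (le_abs_self _).trans ?_
  rw [abs_mul]
  exact mul_le_mul_of_nonneg_left (norm_le_pi_norm (V.mulVec h) j) (abs_nonneg _)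

end Norms

section Selector

variable {d : ℕ} (φ : ℕ → ℝ → ℝ) (n : ℕ) {δ : ℝ} (x : ℝ≥0 → Fin d → ℝ) (i : Fin d)

theorem sigmaHatSq_nonneg (hδ : 0 ≤ δ) : 0 ≤ sigmaHatSq n δ x i :=
  mul_nonneg (by positivity) (Finset.sum_nonneg fun _ _ => by positivity)

theorem score_sub_score (hδ : δ ≠ 0) (θ θ' : Fin d → ℝ) :
    score φ n δ x i θ - score φ n δ x i θ' = (hessian φ n δ x i).mulVec (θ' - θ) := by
  funext j
  simp only [Pi.sub_apply, score, hessian, Matrix.mulVec, dotProduct, Matrix.of_apply]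
  rw [← mul_sub, ← Finset.sum_sub_distrib]
  have h1 : ∀ k, φ j (obs x δ k j) * (obs x δ (k + 1) i - obs x δ k i
      - (∑ l, θ l * φ l (obs x δ k l)) * δ) - φ j (obs x δ k j) * (obs x δ (k + 1) i - obs x δ k i
      - (∑ l, θ' l * φ l (obs x δ k l)) * δ)
      = δ * ∑ l : Fin d, φ j (obs x δ k j) * φ l (obs x δ k l) * (θ' l - θ l) := by
    intro k
    have : ∑ l : Fin d, φ j (obs x δ k j) * φ l (obs x δ k l) * (θ' l - θ l)
        = φ j (obs x δ k j) * (∑ l, θ' l * φ l (obs x δ k l) - ∑ l, θ l * φ l (obs x δ k l)) := by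
      rw [← Finset.sum_sub_distrib, Finset.mul_sum]
      exact Finset.sum_congr rfl fun l _ => by ring
    rw [this]; ring
  simp_rw [h1]
  rw [← Finset.mul_sum, Finset.sum_comm, ← mul_assoc, Finset.mul_sum]
  refine Finset.sum_congr rfl fun l _ => ?_
  rw [← Finset.sum_mul, ← mul_assoc]
  congr 2
  rcases eq_or_ne (n : ℝ) 0 with hn | hn
  · simp [hn]
  rcases eq_or_ne (sigmaHatSq n δ x i) 0 with hs | hs
  · simp [hs]
  field_simp

theorem quadForm_hessian_nonneg (hδ : 0 ≤ δ) (h : Fin d → ℝ) :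
    0 ≤ quadForm (hessian φ n δ x i) h := by
  have hs := sigmaHatSq_nonneg n x i hδ
  have : quadForm (hessian φ n δ x i) h = 1 / (n * sigmaHatSq n δ x i) *
      ∑ k ∈ Finset.range n, (∑ l, h l * φ l (obs x δ k l)) ^ 2 := by
    simp only [quadForm, hessian, Matrix.mulVec, dotProduct, Matrix.of_apply, sq,
      Finset.sum_mul_sum]
    simp only [Finset.mul_sum, Finset.sum_mul]
    refine Eq.trans (Finset.sum_congr rfl fun j _ => ?_) Finset.sum_comm
    refine Eq.trans (Finset.sum_congr rfl fun l _ => Finset.sum_congr rfl fun k _ => ?_)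
      Finset.sum_comm
    ring
  rw [this]
  exact mul_nonneg (by positivity) (Finset.sum_nonneg fun _ _ => sq_nonneg _)

variable {φ n x i} in
theorem IsDantzigSelector.sub_row_mem_cone {γ : ℝ} {Θ : ℕ → ℕ → ℝ} {θ : Fin d → ℝ}
    (hθ : IsDantzigSelector φ n δ γ x i θ) (hs : ‖score φ n δ x i (row Θ i)‖ ≤ γ) :
    θ - row Θ i ∈ cone (rowSupport Θ i) :=
  sub_mem_cone (fun j hj => by simpa [rowSupport] using hj) (hθ.1 hs)

variable {φ n x i} in
theorem IsDantzigSelector.quadForm_sub_row_le {γ : ℝ} {Θ : ℕ → ℕ → ℝ} {θ : Fin d → ℝ}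
    (hδ : δ ≠ 0) (hγ : 0 < γ)
    (hθ : IsDantzigSelector φ n δ γ x i θ) (hs : ‖score φ n δ x i (row Θ i)‖ ≤ γ / 2) :
    quadForm (hessian φ n δ x i) (θ - row Θ i) ≤ 3 * l1Norm (row Θ i) * γ := by
  have h1 : l1Norm (θ - row Θ i) ≤ 2 * l1Norm (row Θ i) := by
    have h : l1Norm θ ≤ l1Norm (row Θ i) :=
      hθ.1 (show _ ≤ _ from hs.trans (by linarith))
    linarith [l1Norm_sub_le θ (row Θ i)]
  have h2 : ‖(hessian φ n δ x i).mulVec (θ - row Θ i)‖ ≤ 3 / 2 * γ := by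
    rw [← score_sub_score φ n x i hδ]
    have h : ‖score φ n δ x i θ‖ ≤ γ := hθ.2
    linarith [norm_sub_le (score φ n δ x i (row Θ i)) (score φ n δ x i θ)]
  calc _ ≤ l1Norm (θ - row Θ i) * ‖(hessian φ n δ x i).mulVec (θ - row Θ i)‖ := quadForm_le _ _
    _ ≤ 2 * l1Norm (row Θ i) * (3 / 2 * γ) :=
      mul_le_mul h1 h2 (norm_nonneg _) (by linarith [l1Norm_nonneg (row Θ i)])
    _ = _ := by ring

end Selector

/-! ### Matrix factors -/

section Factors

variable {d : ℕ} {T : Finset (Fin d)} {V : Matrix (Fin d) (Fin d) ℝ} {h : Fin d → ℝ}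

theorem sq_mul_ofReal_sq_le {F : ℝ≥0∞} {q N : ℝ} (hq : 0 ≤ q) (hN : 0 < N)
    (hF : F ≤ ENNReal.ofReal (√q / N)) : F ^ 2 * ENNReal.ofReal (N ^ 2) ≤ ENNReal.ofReal q := by
  calc F ^ 2 * ENNReal.ofReal (N ^ 2)
      ≤ ENNReal.ofReal (√q / N) ^ 2 * ENNReal.ofReal (N ^ 2) := by gcongr
    _ = ENNReal.ofReal q := by
      rw [← ENNReal.ofReal_pow (by positivity), ← ENNReal.ofReal_mul (by positivity), div_pow,
        Real.sq_sqrt hq, div_mul_cancel₀ _ (by positivity)]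

theorem RE_sq_mul_le (hV : 0 ≤ quadForm V h) (hh : h ∈ cone T) :
    RE T V ^ 2 * ENNReal.ofReal (l2Norm h ^ 2) ≤ ENNReal.ofReal (quadForm V h) := by
  rcases eq_or_ne h 0 with h0 | h0
  · simp [h0, l2Norm]
  · exact sq_mul_ofReal_sq_le hV (l2Norm_pos h0) (iInf₂_le h ⟨h0, hh⟩)

theorem FInfty_sq_mul_le (hV : 0 ≤ quadForm V h) (hh : h ∈ cone T) :
    FInfty T V ^ 2 * ENNReal.ofReal (‖h‖ ^ 2) ≤ ENNReal.ofReal (quadForm V h) := by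
  rcases eq_or_ne h 0 with h0 | h0
  · simp [h0]
  · exact sq_mul_ofReal_sq_le hV (norm_pos_iff.2 h0) (iInf₂_le h ⟨h0, hh⟩)

theorem exists_ne_zero_mem_cone (hT : T.Nonempty) : ∃ h : Fin d → ℝ, h ≠ 0 ∧ h ∈ cone T := by
  obtain ⟨j, hj⟩ := hT
  refine ⟨Pi.single j 1, by simp, ?_⟩
  change ∑ l ∈ Tᶜ, |(Pi.single j 1 : Fin d → ℝ) l| ≤ ∑ l ∈ T, |(Pi.single j 1 : Fin d → ℝ) l|
  rw [Finset.sum_eq_zero fun l hl => ?_]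
  · exact Finset.sum_nonneg fun _ _ => abs_nonneg _
  · have : l ≠ j := fun e => Finset.mem_compl.1 hl (e ▸ hj)
    simp [this]

theorem RE_ne_top (hT : T.Nonempty) : RE T V ≠ ⊤ := by
  obtain ⟨h, hh⟩ := exists_ne_zero_mem_cone hT
  exact ne_top_of_le_ne_top ENNReal.ofReal_ne_top (iInf₂_le h hh)

theorem FInfty_ne_top (hT : T.Nonempty) : FInfty T V ≠ ⊤ := by
  obtain ⟨h, hh⟩ := exists_ne_zero_mem_cone hT
  exact ne_top_of_le_ne_top ENNReal.ofReal_ne_top (iInf₂_le h hh)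

theorem sq_l1Norm_le_of_lt_kappa {c : ℝ} (hc : 0 < c) (hV : 0 ≤ quadForm V h)
    (hκ : ENNReal.ofReal c < kappa T V) (hh : h ∈ cone T) :
    c ^ 2 * l1Norm h ^ 2 ≤ 4 * T.card * quadForm V h := by
  rcases eq_or_ne h 0 with h0 | h0
  · simp [h0, l1Norm, quadForm]
  have h1 : ENNReal.ofReal c < ENNReal.ofReal (√(T.card : ℝ) * √(quadForm V h) / ∑ j ∈ T, |h j|) :=
    hκ.trans_le (iInf₂_le h ⟨h0, hh⟩)
  have h2 := (ENNReal.ofReal_lt_ofReal_iff_of_nonneg hc.le).1 h1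
  have hs0 : 0 ≤ ∑ j ∈ T, |h j| := Finset.sum_nonneg fun _ _ => abs_nonneg _
  have hs : 0 < ∑ j ∈ T, |h j| := by
    refine lt_of_le_of_ne hs0 fun e => ?_
    rw [← e, div_zero] at h2
    linarith
  rw [lt_div_iff₀ hs] at h2
  have h3 := l1Norm_le_two_mul_of_mem_cone hh
  have h4 : c * l1Norm h ≤ 2 * (√(T.card : ℝ) * √(quadForm V h)) := by
    nlinarith
  calc c ^ 2 * l1Norm h ^ 2 = (c * l1Norm h) ^ 2 := by ring
    _ ≤ (2 * (√(T.card : ℝ) * √(quadForm V h))) ^ 2 :=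
      pow_le_pow_left₀ (mul_nonneg hc.le (l1Norm_nonneg h)) h4 2
    _ = _ := by
      rw [mul_pow, mul_pow, Real.sq_sqrt (Nat.cast_nonneg _), Real.sq_sqrt hV]; ring

theorem iSup_lt_div_iInf {ι : Type*} [Finite ι] [Nonempty ι] {R S A : ι → ℝ≥0∞} {g : ℝ≥0∞}
    (hRS : ∀ i, R i * S i ≤ 3 * A i * g) (hS : ∀ i, S i ≠ ⊤) (hA0 : ∃ i, A i ≠ 0)
    (hA : ∀ i, A i ≠ ⊤) (hg0 : g ≠ 0) (hg : g ≠ ⊤) (hR : ∃ i, R i ≠ ⊤) :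
    ⨆ i, S i < 4 * (⨆ i, A i) * g / ⨅ i, R i := by
  have hsup : ∀ {f : ι → ℝ≥0∞}, (∀ i, f i ≠ ⊤) → ⨆ i, f i ≠ ⊤ := fun {f} hf => by
    obtain ⟨i, hi⟩ := exists_eq_ciSup_of_finite (f := f)
    exact hi ▸ hf i
  have hA0' : ⨆ i, A i ≠ 0 := by
    obtain ⟨i, hi⟩ := hA0
    exact fun e => hi (le_zero_iff.1 (e ▸ le_iSup A i))
  have hR' : ⨅ i, R i ≠ ⊤ := by
    obtain ⟨i, hi⟩ := hR
    exact ne_top_of_le_ne_top hi (iInf_le R i)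
  have hA' := hsup hA
  rcases eq_or_ne (⨅ i, R i) 0 with h0 | h0
  · rw [h0, ENNReal.div_zero (by simp [hA0', hg0])]
    exact (hsup hS).lt_top
  · have hle : ⨆ i, S i ≤ 3 * (⨆ i, A i) * g / ⨅ i, R i := by
      refine iSup_le fun i => ?_
      rw [ENNReal.le_div_iff_mul_le (Or.inl h0) (Or.inl hR')]
      calc S i * ⨅ i, R i ≤ S i * R i := by gcongr; exact iInf_le R i
        _ = R i * S i := mul_comm _ _
        _ ≤ 3 * A i * g := hRS i
        _ ≤ _ := by gcongr; exact le_iSup A i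
    refine hle.trans_lt (ENNReal.div_lt_div_right h0 hR' ?_)
    rw [mul_assoc, mul_assoc]
    exact ENNReal.mul_lt_mul_left (mul_ne_zero hA0' hg0) (ENNReal.mul_ne_top hA' hg) (by norm_num)

end Factors

/-! ### Pathwise estimates -/

/-- The drift of the `i`-th coordinate along the path `x`. -/
noncomputable def pathDrift (φ : ℕ → ℝ → ℝ) (Θ : ℕ → ℕ → ℝ) {d : ℕ}
    (x : ℝ≥0 → Fin d → ℝ) (i : Fin d) (s : ℝ) : ℝ := ∑ j : Fin d, Θ i j * φ j (x s.toNNReal j)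

/-- A continuous path `x` solving the integral equation driven by the continuous path `w`, with
bounded Lipschitz `φ` and rows of `Θ` bounded by `B` in `l_1`. -/
structure IsRegularPath (φ : ℕ → ℝ → ℝ) (Θ : ℕ → ℕ → ℝ) (σ : ℕ → ℝ) {d : ℕ}
    (x : ℝ≥0 → Fin d → ℝ) (w : ℕ → ℝ≥0 → ℝ) (L L' B K : ℝ) : Prop where
  continuous_path : Continuous x
  continuous_noise : ∀ i : Fin d, Continuous (w i)
  equation : ∀ (t : ℝ≥0) (i : Fin d),
    x t i = x 0 i + (∫ s in (0 : ℝ)..t, pathDrift φ Θ x i s) + σ i * w i t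
  bounded : ∀ i y, |φ i y| ≤ L
  lipschitz_nonneg : 0 ≤ L'
  lipschitz : ∀ i y z, |φ i y - φ i z| ≤ L' * |y - z|
  row_bound : ∀ i : Fin d, l1Norm (row Θ i) ≤ B
  sigma_bound : ∀ i, |σ i| ≤ K

theorem continuous_of_lipschitz_bound {f : ℝ → ℝ} {C : ℝ} (hC : 0 ≤ C)
    (h : ∀ y z, |f y - f z| ≤ C * |y - z|) : Continuous f :=
  (LipschitzWith.of_dist_le_mul (K := ⟨C, hC⟩) fun y z => by
    rw [Real.dist_eq, Real.dist_eq]; exact h y z).continuous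

namespace IsRegularPath

variable {φ : ℕ → ℝ → ℝ} {Θ : ℕ → ℕ → ℝ} {σ : ℕ → ℝ} {d : ℕ} {x : ℝ≥0 → Fin d → ℝ}
  {w : ℕ → ℝ≥0 → ℝ} {L L' B K : ℝ}

theorem bound_nonneg (h : IsRegularPath φ Θ σ x w L L' B K) : 0 ≤ L :=
  (abs_nonneg _).trans (h.bounded 0 0)

theorem continuous_coord (h : IsRegularPath φ Θ σ x w L L' B K) (i : Fin d) :
    Continuous fun s : ℝ => x s.toNNReal i :=
  (continuous_apply i).comp (h.continuous_path.comp continuous_real_toNNReal)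

theorem continuous_noise_real (h : IsRegularPath φ Θ σ x w L L' B K) (i : Fin d) :
    Continuous fun s : ℝ => w i s.toNNReal :=
  (h.continuous_noise i).comp continuous_real_toNNReal

theorem continuous_pathDrift (h : IsRegularPath φ Θ σ x w L L' B K) (i : Fin d) :
    Continuous (pathDrift φ Θ x i) :=
  continuous_finsetSum _ fun j _ => continuous_const.mul
    ((continuous_of_lipschitz_bound h.lipschitz_nonneg (h.lipschitz j)).comp (h.continuous_coord j))

theorem abs_pathDrift_le (h : IsRegularPath φ Θ σ x w L L' B K) (i : Fin d) (s : ℝ) :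
    |pathDrift φ Θ x i s| ≤ B * L := by
  calc |pathDrift φ Θ x i s| ≤ ∑ j : Fin d, |Θ i j * φ j (x s.toNNReal j)| :=
        Finset.abs_sum_le_sum_abs _ _
    _ ≤ ∑ j : Fin d, |row Θ i j| * L := Finset.sum_le_sum fun j _ => by
        rw [abs_mul]; exact mul_le_mul_of_nonneg_left (h.bounded _ _) (abs_nonneg _)
    _ = l1Norm (row Θ i) * L := by rw [← Finset.sum_mul]; rfl
    _ ≤ B * L := mul_le_mul_of_nonneg_right (h.row_bound i) h.bound_nonneg

theorem increment_eq (h : IsRegularPath φ Θ σ x w L L' B K) (i : Fin d) {s t : ℝ} (hs : 0 ≤ s)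
    (hst : s ≤ t) : x t.toNNReal i - x s.toNNReal i
      = (∫ u in s..t, pathDrift φ Θ x i u) + σ i * (w i t.toNNReal - w i s.toNNReal) := by
  have hint : ∀ a b, IntervalIntegrable (pathDrift φ Θ x i) volume a b := fun a b =>
    (h.continuous_pathDrift i).intervalIntegrable a b
  rw [h.equation t.toNNReal, h.equation s.toNNReal, Real.coe_toNNReal _ hs,
    Real.coe_toNNReal _ (hs.trans hst), ← intervalIntegral.integral_interval_sub_left
      (hint 0 t) (hint 0 s)]
  ring

theorem abs_increment_sub_le (h : IsRegularPath φ Θ σ x w L L' B K) (i : Fin d) {s t : ℝ}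
    (hs : 0 ≤ s) (hst : s ≤ t) :
    |x t.toNNReal i - x s.toNNReal i - σ i * (w i t.toNNReal - w i s.toNNReal)|
      ≤ B * L * (t - s) := by
  rw [h.increment_eq i hs hst, add_sub_cancel_right]
  have := intervalIntegral.norm_integral_le_of_norm_le_const (a := s) (b := t)
    (f := pathDrift φ Θ x i) (C := B * L) fun u _ => h.abs_pathDrift_le i u
  rwa [Real.norm_eq_abs, abs_of_nonneg (sub_nonneg.2 hst)] at this

theorem abs_increment_le (h : IsRegularPath φ Θ σ x w L L' B K) (i : Fin d) {s t : ℝ}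
    (hs : 0 ≤ s) (hst : s ≤ t) :
    |x t.toNNReal i - x s.toNNReal i|
      ≤ B * L * (t - s) + K * |w i t.toNNReal - w i s.toNNReal| := by
  have h1 := h.abs_increment_sub_le i hs hst
  have h2 : |σ i * (w i t.toNNReal - w i s.toNNReal)| ≤ K * |w i t.toNNReal - w i s.toNNReal| := by
    rw [abs_mul]; exact mul_le_mul_of_nonneg_right (h.sigma_bound i) (abs_nonneg _)
  have h3 := abs_add_le (x t.toNNReal i - x s.toNNReal i - σ i * (w i t.toNNReal - w i s.toNNReal))
    (σ i * (w i t.toNNReal - w i s.toNNReal))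
  rw [sub_add_cancel] at h3
  linarith

theorem le_sigmaHatSq (h : IsRegularPath φ Θ σ x w L L' B K) (i : Fin d) {δ : ℝ} (hδ : 0 < δ)
    {n : ℕ} (hn : 1 ≤ n) {κ a : ℝ} (hκ : κ ^ 2 ≤ σ i ^ 2)
    (ha : a * (n * δ) ≤ ∑ k ∈ Finset.range n, (w i (gridTime δ (k + 1)) - w i (gridTime δ k)) ^ 2) :
    κ ^ 2 * a / 2 - (B * L) ^ 2 * δ ≤ sigmaHatSq n δ x i := by
  have hn0 : (0 : ℝ) < n := by exact_mod_cast hn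
  have hk : ∀ k : ℕ, κ ^ 2 / 2 * (w i (gridTime δ (k + 1)) - w i (gridTime δ k)) ^ 2
      - (B * L * δ) ^ 2 ≤ |obs x δ (k + 1) i - obs x δ k i| ^ 2 := by
    intro k
    have hle : (k : ℝ) * δ ≤ ((k + 1 : ℕ) : ℝ) * δ := by
      refine mul_le_mul_of_nonneg_right ?_ hδ.le
      exact_mod_cast k.le_succ
    have h1 := h.abs_increment_sub_le i (by positivity) hle
    have h2 : ((k + 1 : ℕ) : ℝ) * δ - k * δ = δ := by push_cast; ring
    rw [h2] at h1
    change _ ≤ |x (gridTime δ (k + 1)) i - x (gridTime δ k) i| ^ 2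
    change |x (gridTime δ (k + 1)) i - x (gridTime δ k) i
      - σ i * (w i (gridTime δ (k + 1)) - w i (gridTime δ k))| ≤ _ at h1
    set X := x (gridTime δ (k + 1)) i - x (gridTime δ k) i
    set D := w i (gridTime δ (k + 1)) - w i (gridTime δ k)
    have h3 : (X - σ i * D) ^ 2 ≤ (B * L * δ) ^ 2 := sq_le_sq' (abs_le.1 h1).1 (abs_le.1 h1).2
    have h4 : κ ^ 2 * D ^ 2 ≤ σ i ^ 2 * D ^ 2 := mul_le_mul_of_nonneg_right hκ (sq_nonneg D)
    rw [sq_abs]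
    nlinarith [sq_nonneg (2 * X - σ i * D)]
  have hsum := Finset.sum_le_sum fun k (_ : k ∈ Finset.range n) => hk k
  rw [Finset.sum_sub_distrib, ← Finset.mul_sum, Finset.sum_const, Finset.card_range,
    nsmul_eq_mul] at hsum
  rw [sigmaHatSq, one_div, inv_mul_eq_div, le_div_iff₀ (by positivity)]
  have := mul_le_mul_of_nonneg_left ha (show 0 ≤ κ ^ 2 / 2 by positivity)
  calc _ = κ ^ 2 / 2 * (a * (n * δ)) - n * (B * L * δ) ^ 2 := by ring
    _ ≤ _ := by linarith

theorem sum_integral_abs_le (h : IsRegularPath φ Θ σ x w L L' B K) (i : Fin d) {δ : ℝ}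
    (hδ : 0 < δ) (n : ℕ) :
    ∑ k ∈ Finset.range n, ∫ s in (k * δ)..((k + 1) * δ), |x s.toNNReal i - x (gridTime δ k) i|
      ≤ n * (B * L * δ ^ 2) + K * gridOscillation δ n (w i) := by
  have hk : ∀ k ∈ Finset.range n,
      ∫ s in (k * δ)..((k + 1) * δ), |x s.toNNReal i - x (gridTime δ k) i|
      ≤ B * L * δ ^ 2
        + K * ∫ s in (k * δ)..((k + 1) * δ), |w i s.toNNReal - w i (gridTime δ k)| := by
    intro k _
    have hle : (k : ℝ) * δ ≤ (k + 1) * δ := by nlinarith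
    have hk0 : 0 ≤ (k : ℝ) * δ := by positivity
    have hw : Continuous fun s : ℝ => |w i s.toNNReal - w i (gridTime δ k)| :=
      ((h.continuous_noise_real i).sub continuous_const).abs
    have hx : Continuous fun s : ℝ => |x s.toNNReal i - x (gridTime δ k) i| :=
      ((h.continuous_coord i).sub continuous_const).abs
    have hBL : 0 ≤ B * L := (abs_nonneg _).trans (h.abs_pathDrift_le i 0)
    have hwi := hw.intervalIntegrable (μ := volume) (k * δ) ((k + 1) * δ)
    calc _ ≤ ∫ s in (k * δ)..((k + 1) * δ),
          (B * L * δ + K * |w i s.toNNReal - w i (gridTime δ k)|) := by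
          refine intervalIntegral.integral_mono_on hle (hx.intervalIntegrable _ _)
            (intervalIntegrable_const.add (hwi.const_mul K)) fun s hs => ?_
          refine (h.abs_increment_le i hk0 hs.1).trans (add_le_add ?_ le_rfl)
          exact mul_le_mul_of_nonneg_left (by linarith [hs.2]) hBL
      _ = _ := by
          rw [intervalIntegral.integral_add intervalIntegrable_const (hwi.const_mul K),
            intervalIntegral.integral_const, intervalIntegral.integral_const_mul, smul_eq_mul]
          ring
  refine (Finset.sum_le_sum hk).trans_eq ?_
  rw [Finset.sum_add_distrib, Finset.sum_const, Finset.card_range, nsmul_eq_mul,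
    gridOscillation, Finset.mul_sum]

theorem abs_residual_le (h : IsRegularPath φ Θ σ x w L L' B K) (i : Fin d) {δ : ℝ} (hδ : 0 < δ)
    (k : ℕ) :
    |obs x δ (k + 1) i - obs x δ k i - (∑ l, row Θ i l * φ l (obs x δ k l)) * δ
        - σ i * (w i (gridTime δ (k + 1)) - w i (gridTime δ k))|
      ≤ ∑ l, |row Θ i l| * (L' *
        ∫ s in (k * δ)..((k + 1) * δ), |x s.toNNReal l - x (gridTime δ k) l|) := by
  have hle : (k : ℝ) * δ ≤ (k + 1) * δ := by nlinarith
  have hk0 : 0 ≤ (k : ℝ) * δ := by positivity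
  have hinc := h.increment_eq i hk0 hle
  have hsucc : ((k : ℝ) + 1) * δ = ((k + 1 : ℕ) : ℝ) * δ := by push_cast; ring
  have hd := (h.continuous_pathDrift i)
  have hdi := hd.intervalIntegrable (μ := volume) (k * δ) ((k + 1) * δ)
  have hx : ∀ l, Continuous fun s : ℝ => |x s.toNNReal l - x (gridTime δ k) l| := fun l =>
    ((h.continuous_coord l).sub continuous_const).abs
  have heq : obs x δ (k + 1) i - obs x δ k i - (∑ l, row Θ i l * φ l (obs x δ k l)) * δ
        - σ i * (w i (gridTime δ (k + 1)) - w i (gridTime δ k))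
      = ∫ s in (k * δ)..((k + 1) * δ), (pathDrift φ Θ x i s - pathDrift φ Θ x i (k * δ)) := by
    rw [intervalIntegral.integral_sub hdi intervalIntegrable_const,
      intervalIntegral.integral_const, smul_eq_mul]
    have h1 : obs x δ (k + 1) i - obs x δ k i
        = (∫ u in (k * δ)..((k + 1) * δ), pathDrift φ Θ x i u)
          + σ i * (w i (gridTime δ (k + 1)) - w i (gridTime δ k)) := by
      rw [gridTime, gridTime, ← hsucc, ← hinc, hsucc]; rfl
    have h2 : ∑ l, row Θ i l * φ l (obs x δ k l) = pathDrift φ Θ x i (k * δ) := rfl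
    rw [h1, h2]; ring
  rw [heq]
  have hpt : ∀ s, ‖pathDrift φ Θ x i s - pathDrift φ Θ x i (k * δ)‖
      ≤ ∑ l, |row Θ i l| * (L' * |x s.toNNReal l - x (gridTime δ k) l|) := by
    intro s
    rw [Real.norm_eq_abs, pathDrift, pathDrift, ← Finset.sum_sub_distrib]
    refine (Finset.abs_sum_le_sum_abs _ _).trans (Finset.sum_le_sum fun l _ => ?_)
    rw [← mul_sub, abs_mul]
    exact mul_le_mul_of_nonneg_left (h.lipschitz _ _ _) (abs_nonneg _)
  have hci : ∀ l ∈ Finset.univ, IntervalIntegrable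
      (fun s => |row Θ i l| * (L' * |x s.toNNReal l - x (gridTime δ k) l|))
      volume (k * δ) ((k + 1) * δ) := fun l _ =>
    (continuous_const.mul (continuous_const.mul (hx l))).intervalIntegrable _ _
  calc _ ≤ ∫ s in (k * δ)..((k + 1) * δ),
        ∑ l, |row Θ i l| * (L' * |x s.toNNReal l - x (gridTime δ k) l|) :=
        intervalIntegral.norm_integral_le_of_norm_le hle (ae_of_all _ fun s _ => hpt s)
          ((continuous_finsetSum _ fun l _ =>
            continuous_const.mul (continuous_const.mul (hx l))).intervalIntegrable _ _)
    _ = _ := by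
        rw [intervalIntegral.integral_finsetSum hci]
        simp only [intervalIntegral.integral_const_mul]

theorem norm_score_le (h : IsRegularPath φ Θ σ x w L L' B K) (i : Fin d) {δ : ℝ} (hδ : 0 < δ)
    {n : ℕ} (hn : 1 ≤ n) {c u m : ℝ} (hc : 0 < c) (hσ : c ≤ sigmaHatSq n δ x i)
    (hu : ∀ l : Fin d, gridOscillation δ n (w l) ≤ u)
    (hm : ∀ j : Fin d, |∑ k ∈ Finset.range n, φ j (obs x δ k j) *
      (w i (gridTime δ (k + 1)) - w i (gridTime δ k))| ≤ m) :
    ‖score φ n δ x i (row Θ i)‖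
      ≤ (L * L' * B * (n * (B * L * δ ^ 2) + K * u) + K * m) / (n * δ * c) := by
  have hn0 : (0 : ℝ) < n := by exact_mod_cast hn
  have hL := h.bound_nonneg
  have hL' := h.lipschitz_nonneg
  have hB : 0 ≤ B := (l1Norm_nonneg _).trans (h.row_bound i)
  have hK : 0 ≤ K := (abs_nonneg _).trans (h.sigma_bound 0)
  set U : ℝ := n * (B * L * δ ^ 2) + K * u with hU
  have hUle : ∀ l : Fin d, ∑ k ∈ Finset.range n,
      ∫ s in (k * δ)..((k + 1) * δ), |x s.toNNReal l - x (gridTime δ k) l| ≤ U := fun l =>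
    (h.sum_integral_abs_le l hδ n).trans (by
      rw [hU]; gcongr; exact hu l)
  have hU0 : 0 ≤ U := (Finset.sum_nonneg fun k _ => intervalIntegral.integral_nonneg (by nlinarith)
    fun s _ => abs_nonneg _).trans (hUle i)
  have hm0 : 0 ≤ m := (abs_nonneg _).trans (hm i)
  have hnum0 : 0 ≤ L * L' * B * U + K * m := by positivity
  refine (pi_norm_le_iff_of_nonneg (by positivity)).2 fun j => ?_
  set r : ℕ → ℝ := fun k => obs x δ (k + 1) i - obs x δ k i
    - (∑ l, row Θ i l * φ l (obs x δ k l)) * δ with hr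
  set D : ℕ → ℝ := fun k => w i (gridTime δ (k + 1)) - w i (gridTime δ k) with hD
  have hsplit : ∑ k ∈ Finset.range n, φ j (obs x δ k j) * r k
      = ∑ k ∈ Finset.range n, φ j (obs x δ k j) * (r k - σ i * D k)
        + σ i * ∑ k ∈ Finset.range n, φ j (obs x δ k j) * D k := by
    rw [Finset.mul_sum, ← Finset.sum_add_distrib]
    exact Finset.sum_congr rfl fun k _ => by ring
  have h1 : |∑ k ∈ Finset.range n, φ j (obs x δ k j) * (r k - σ i * D k)| ≤ L * L' * B * U := by
    calc _ ≤ ∑ k ∈ Finset.range n, |φ j (obs x δ k j) * (r k - σ i * D k)| :=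
          Finset.abs_sum_le_sum_abs _ _
      _ ≤ ∑ k ∈ Finset.range n, L * ∑ l, |row Θ i l| * (L' *
            ∫ s in (k * δ)..((k + 1) * δ), |x s.toNNReal l - x (gridTime δ k) l|) :=
          Finset.sum_le_sum fun k _ => by
            rw [abs_mul]
            exact mul_le_mul (h.bounded _ _) (h.abs_residual_le i hδ k) (abs_nonneg _) hL
      _ = L * ∑ l, |row Θ i l| * (L' * ∑ k ∈ Finset.range n,
            ∫ s in (k * δ)..((k + 1) * δ), |x s.toNNReal l - x (gridTime δ k) l|) := by
          rw [← Finset.mul_sum, Finset.sum_comm]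
          simp only [Finset.mul_sum]
      _ ≤ L * ∑ l, |row Θ i l| * (L' * U) := by
          gcongr with l
          exact hUle l
      _ = L * (l1Norm (row Θ i) * (L' * U)) := by rw [← Finset.sum_mul]; rfl
      _ ≤ L * (B * (L' * U)) := by
          gcongr; exact h.row_bound i
      _ = _ := by ring
  have h2 : |σ i * ∑ k ∈ Finset.range n, φ j (obs x δ k j) * D k| ≤ K * m := by
    rw [abs_mul]
    exact mul_le_mul (h.sigma_bound i) (hm j) (abs_nonneg _) hK
  have h3 : |∑ k ∈ Finset.range n, φ j (obs x δ k j) * r k| ≤ L * L' * B * U + K * m := by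
    rw [hsplit]; exact (abs_add_le _ _).trans (add_le_add h1 h2)
  change |1 / (n * δ * sigmaHatSq n δ x i) * ∑ k ∈ Finset.range n, φ j (obs x δ k j) * r k| ≤ _
  have hs : 0 < sigmaHatSq n δ x i := hc.trans_le hσ
  rw [abs_mul, abs_of_pos (by positivity), one_div, inv_mul_eq_div]
  exact div_le_div₀ hnum0 h3 (by positivity) (by gcongr)

end IsRegularPath

/-! ### The score at the true parameter -/

theorem exists_gaussianSqLaplace_le :
    ∃ a : ℝ, 0 < a ∧ gaussianSqLaplace ≤ ENNReal.ofReal (Real.exp (-(2 * a))) := by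
  have h1 := gaussianSqLaplace_lt_one
  have hne : gaussianSqLaplace ≠ ⊤ := (h1.trans ENNReal.one_lt_top).ne
  have h2 : gaussianSqLaplace.toReal < 1 := by
    simpa using (ENNReal.toReal_lt_toReal hne ENNReal.one_ne_top).2 h1
  refine ⟨(1 - gaussianSqLaplace.toReal) / 2, by linarith, ?_⟩
  rw [← ENNReal.ofReal_toReal hne]
  refine ENNReal.ofReal_le_ofReal ?_
  rw [ENNReal.toReal_ofReal ENNReal.toReal_nonneg]
  linarith [Real.add_one_le_exp (-(2 * ((1 - gaussianSqLaplace.toReal) / 2)))]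

theorem measure_iUnion_fintype_le_card_mul {Ω ι : Type*} [MeasurableSpace Ω] [Fintype ι]
    (P : Measure Ω) {s : ι → Set Ω} {c : ℝ≥0∞} (h : ∀ i, P (s i) ≤ c) :
    P (⋃ i, s i) ≤ Fintype.card ι * c := by
  refine (measure_iUnion_fintype_le P s).trans ((Finset.sum_le_sum fun i _ => h i).trans_eq ?_)
  simp

theorem IsSolution.ae_isRegularPath {Ω : Type*} {F₀ : MeasurableSpace Ω}
    [mΩ : MeasurableSpace Ω] {P : Measure Ω} {W : ℕ → ℝ≥0 → Ω → ℝ}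
    (hW : IsBrownianBasis F₀ P W) {φ : ℕ → ℝ → ℝ} {Θ : ℕ → ℕ → ℝ} {σ : ℕ → ℝ} {d : ℕ}
    {X : ℝ≥0 → Ω → Fin d → ℝ} (hX : IsSolution F₀ P W φ Θ σ X) {L L' B K : ℝ}
    (hL : ∀ i y, |φ i y| ≤ L) (hL'0 : 0 ≤ L') (hL' : ∀ i y z, |φ i y - φ i z| ≤ L' * |y - z|)
    (hB : ∀ i : Fin d, l1Norm (row Θ i) ≤ B) (hK : ∀ i, |σ i| ≤ K) :
    ∀ᵐ ω ∂P, IsRegularPath φ Θ σ (fun t => X t ω) (fun i t => W i t ω) L L' B K := by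
  have hcont : ∀ᵐ ω ∂P, ∀ i, Continuous fun t => W i t ω :=
    ae_all_iff.2 fun i => (hW.brownian i).cont
  filter_upwards [hcont, hX.continuous, hX.equation] with ω h1 h2 h3
  exact ⟨h2, fun i => h1 i, h3, hL, hL'0, hL', hB, hK⟩

theorem measure_score_row_gt_le {Ω : Type*} {F₀ : MeasurableSpace Ω}
    [mΩ : MeasurableSpace Ω] {P : Measure Ω} [IsProbabilityMeasure P] {W : ℕ → ℝ≥0 → Ω → ℝ}
    (hW : IsBrownianBasis F₀ P W) {φ : ℕ → ℝ → ℝ} {Θ : ℕ → ℕ → ℝ} {σ : ℕ → ℝ} {d : ℕ}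
    {X : ℝ≥0 → Ω → Fin d → ℝ} (hX : IsSolution F₀ P W φ Θ σ X) {L L' B K κ : ℝ} (hL0 : 0 < L)
    (hL : ∀ i y, |φ i y| ≤ L) (hL'0 : 0 ≤ L') (hL' : ∀ i y z, |φ i y - φ i z| ≤ L' * |y - z|)
    (hB : ∀ i : Fin d, l1Norm (row Θ i) ≤ B) (hK : ∀ i, |σ i| ≤ K) (hκ0 : 0 ≤ κ)
    (hκ : ∀ i, κ ≤ |σ i|) {n : ℕ} (hn : 1 ≤ n) {δ : ℝ} (hδ : 0 < δ) {a b c m : ℝ}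
    (ha : gaussianSqLaplace ≤ ENNReal.ofReal (Real.exp (-(2 * a)))) (hc : 0 < c)
    (hac : c ≤ κ ^ 2 * a / 2 - (B * L) ^ 2 * δ) (hm : 0 < m) :
    P {ω | ¬ ∀ i, ‖score φ n δ (fun t => X t ω) i (row Θ i)‖
        ≤ (L * L' * B * (n * (B * L * δ ^ 2) + K * (b * √δ * (n * δ))) + K * m) / (n * δ * c)}
      ≤ d * (d * (2 * ENNReal.ofReal (Real.exp (-(m ^ 2 / (2 * L ^ 2 * (n * δ)))))))
        + d * (2 * ENNReal.ofReal (Real.exp (1 / 2)) * ENNReal.ofReal (Real.exp (-b)))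
        + d * ENNReal.ofReal (Real.exp (-(n * a))) := by
  let M : Fin d → Fin d → Set Ω := fun i j => {ω | m ≤ |∑ k ∈ Finset.range n,
    φ j (X (gridTime δ k) ω j) * (W i (gridTime δ (k + 1)) ω - W i (gridTime δ k) ω)|}
  let U : Fin d → Set Ω := fun l =>
    {ω | b * √δ * (n * δ) ≤ gridOscillation δ n fun t => W l t ω}
  let Q : Fin d → Set Ω := fun i => {ω | ∑ k ∈ Finset.range n,
    (W i (gridTime δ (k + 1)) ω - W i (gridTime δ k) ω) ^ 2 ≤ a * (n * δ)}
  have hM : ∀ i j, P (M i j)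
      ≤ 2 * ENNReal.ofReal (Real.exp (-(m ^ 2 / (2 * L ^ 2 * (n * δ))))) := fun i j =>
    hW.measure_le_abs_sum_mul_increment_le i hδ (Y := fun k ω => φ j (X (gridTime δ k) ω j))
      (fun k => (continuous_of_lipschitz_bound hL'0 (hL' j)).measurable.comp (hX.adapted _ j))
      hL0 (fun k ω => hL _ _) hn hm
  have hU : ∀ l, P (U l) ≤ 2 * ENNReal.ofReal (Real.exp (1 / 2)) * ENNReal.ofReal (Real.exp (-b)) :=
    fun l => hW.measure_le_gridOscillation_le l hδ hn b
  have hQ : ∀ i, P (Q i) ≤ ENNReal.ofReal (Real.exp (-(n * a))) := fun i => by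
    refine (hW.measure_sum_sq_increment_le i hδ n a).trans ?_
    calc _ ≤ ENNReal.ofReal (Real.exp (n * a)) * ENNReal.ofReal (Real.exp (-(2 * a))) ^ n := by
          gcongr
      _ = _ := by
          rw [← ENNReal.ofReal_pow (Real.exp_pos _).le, ← Real.exp_nat_mul,
            ← ENNReal.ofReal_mul (Real.exp_pos _).le, ← Real.exp_add]
          congr 2; ring
  have hsub : P {ω | ¬ ∀ i, ‖score φ n δ (fun t => X t ω) i (row Θ i)‖
        ≤ (L * L' * B * (n * (B * L * δ ^ 2) + K * (b * √δ * (n * δ))) + K * m) / (n * δ * c)}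
      ≤ P ((⋃ i, ⋃ j, M i j) ∪ (⋃ l, U l) ∪ ⋃ i, Q i) := by
    refine measure_mono_ae ?_
    filter_upwards [hX.ae_isRegularPath hW hL hL'0 hL' hB hK] with ω hω hbad
    by_contra hgood
    refine hbad fun i => ?_
    change ω ∉ (⋃ i, ⋃ j, M i j) ∪ (⋃ l, U l) ∪ ⋃ i, Q i at hgood
    simp only [Set.mem_union, Set.mem_iUnion, not_or, not_exists] at hgood
    obtain ⟨⟨hgM, hgU⟩, hgQ⟩ := hgood
    have hσ := hω.le_sigmaHatSq i hδ hn (κ := κ) (a := a)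
      ((pow_le_pow_left₀ hκ0 (hκ i) 2).trans_eq (sq_abs _)) (not_le.1 (hgQ i)).le
    exact hω.norm_score_le i hδ hn hc (hac.trans hσ) (fun l => (not_le.1 (hgU l)).le)
      (fun j => (not_le.1 (hgM i j)).le)
  refine hsub.trans ((measure_union_le _ _).trans (add_le_add ((measure_union_le _ _).trans
    (add_le_add ?_ ?_)) ?_))
  · have h := measure_iUnion_fintype_le_card_mul P fun i =>
      measure_iUnion_fintype_le_card_mul P (hM i)
    simpa using h
  · simpa using measure_iUnion_fintype_le_card_mul P hU
  · simpa using measure_iUnion_fintype_le_card_mul P hQ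

/-! ### Orders of magnitude -/

section Sequences

variable {p : ℕ → ℕ} {Δ γ : ℕ → ℝ}

theorem tendsto_log_one_add_sq (hp : Tendsto p atTop atTop) :
    Tendsto (fun n => Real.log (1 + (p n : ℝ) ^ 2)) atTop atTop := by
  refine Real.tendsto_log_atTop.comp (tendsto_atTop_add_const_left _ 1 ?_)
  exact (tendsto_pow_atTop two_ne_zero).comp (tendsto_natCast_atTop_atTop.comp hp)

theorem tendsto_step {α : ℝ} (hα : 0 < α) (hΔ : Δ =Θ[atTop] fun n => (n : ℝ) ^ (-α)) :
    Tendsto Δ atTop (𝓝 0) :=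
  hΔ.tendsto_zero_iff.2 ((tendsto_rpow_neg_atTop hα).comp tendsto_natCast_atTop_atTop)

theorem tendsto_horizon {α : ℝ} (hα : α < 1) (hpos : ∀ n, 1 ≤ n → 0 < Δ n)
    (hΔ : Δ =Θ[atTop] fun n => (n : ℝ) ^ (-α)) : Tendsto (fun n => n * Δ n) atTop atTop := by
  have h1 : (fun n : ℕ => n * Δ n) =Θ[atTop] fun n => (n : ℝ) * (n : ℝ) ^ (-α) :=
    (isTheta_refl (fun n : ℕ => (n : ℝ)) atTop).mul hΔ
  have h2 : Tendsto (fun n : ℕ => (n : ℝ) * (n : ℝ) ^ (-α)) atTop atTop := by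
    refine ((tendsto_rpow_atTop (sub_pos.2 hα)).comp tendsto_natCast_atTop_atTop).congr' ?_
    filter_upwards [eventually_ge_atTop 1] with n hn
    have hn0 : (0 : ℝ) < n := by exact_mod_cast hn
    rw [Function.comp, sub_eq_add_neg, Real.rpow_add hn0, Real.rpow_one]
  have h3 := h1.tendsto_norm_atTop_iff.2 (tendsto_norm_atTop_atTop.comp h2)
  refine h3.congr' ?_
  filter_upwards [eventually_ge_atTop 1] with n hn
  have hn0 : (0 : ℝ) < n := by exact_mod_cast hn
  exact abs_of_pos (mul_pos hn0 (hpos n hn))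

theorem tendsto_sqrt_mul_step {α : ℝ} (hα : 1 / 2 < α)
    (hΔ : Δ =Θ[atTop] fun n => (n : ℝ) ^ (-α)) : Tendsto (fun n : ℕ => √n * Δ n) atTop (𝓝 0) := by
  have h1 : (fun n : ℕ => √n * Δ n) =Θ[atTop] fun n => √(n : ℝ) * (n : ℝ) ^ (-α) :=
    (isTheta_refl (fun n : ℕ => √(n : ℝ)) atTop).mul hΔ
  refine h1.tendsto_zero_iff.2 ?_
  refine ((tendsto_rpow_neg_atTop (sub_pos.2 hα)).comp tendsto_natCast_atTop_atTop).congr' ?_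
  filter_upwards [eventually_ge_atTop 1] with n hn
  have hn0 : (0 : ℝ) < n := by exact_mod_cast hn
  rw [Function.comp, Real.sqrt_eq_rpow, ← Real.rpow_add hn0]
  congr 1; ring

theorem tendsto_tuning (hp : Tendsto p atTop atTop)
    (hlog : (fun n => Real.log (p n)) =o[atTop] fun n => √(n * Δ n))
    (hT : Tendsto (fun n => n * Δ n) atTop atTop)
    (hγ : γ =Θ[atTop] fun n => Real.log (1 + (p n : ℝ) ^ 2) / √(n * Δ n)) :
    Tendsto γ atTop (𝓝 0) := by
  refine hγ.tendsto_zero_iff.2 ?_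
  have hs : Tendsto (fun n => √(n * Δ n)) atTop atTop := Real.tendsto_sqrt_atTop.comp hT
  have h1 : Tendsto (fun n => Real.log 2 / √(n * Δ n) + 2 * (Real.log (p n) / √(n * Δ n)))
      atTop (𝓝 0) := by
    simpa using (hs.const_div_atTop (Real.log 2)).add (hlog.tendsto_div_nhds_zero.const_mul 2)
  refine squeeze_zero' ?_ ?_ h1
  · exact Eventually.of_forall fun n => div_nonneg
      (Real.log_nonneg (by nlinarith [sq_nonneg (p n : ℝ)]))
      (Real.sqrt_nonneg _)
  · filter_upwards [hp.eventually_ge_atTop 1] with n hn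
    have hp1 : (1 : ℝ) ≤ p n := by exact_mod_cast hn
    have h2 : Real.log (1 + (p n : ℝ) ^ 2) ≤ Real.log 2 + 2 * Real.log (p n) := by
      rw [← Real.log_rpow (by linarith), ← Real.log_mul (by norm_num) (by positivity)]
      refine Real.log_le_log (by positivity) ?_
      rw [Real.rpow_two]
      nlinarith
    calc _ ≤ (Real.log 2 + 2 * Real.log (p n)) / √(n * Δ n) :=
          div_le_div_of_nonneg_right h2 (Real.sqrt_nonneg _)
      _ = _ := by ring

theorem tendsto_dim_mul_exp_neg {a : ℝ} (ha : 0 < a) (hp : Tendsto p atTop atTop)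
    (hlog : (fun n => Real.log (p n)) =o[atTop] fun n => √(n * Δ n))
    (hΔ : Tendsto Δ atTop (𝓝 0)) :
    Tendsto (fun n => (p n : ℝ) * Real.exp (-(n * a))) atTop (𝓝 0) := by
  have h1 : Tendsto (fun n : ℕ => Real.exp (-(n * (a / 2)))) atTop (𝓝 0) :=
    Real.tendsto_exp_neg_atTop_nhds_zero.comp
      (tendsto_natCast_atTop_atTop.atTop_mul_const (half_pos ha))
  refine squeeze_zero' (Eventually.of_forall fun n => by positivity) ?_ h1
  filter_upwards [hlog.bound (half_pos ha), hp.eventually_ge_atTop 1,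
    eventually_ge_atTop 1, hΔ.eventually_le_const zero_lt_one] with n hb hpn hn hΔn
  have hp0 : (0 : ℝ) < p n := by exact_mod_cast hpn
  have hn1 : (1 : ℝ) ≤ n := by exact_mod_cast hn
  have hsqrt : √(n * Δ n) ≤ n := by
    refine Real.sqrt_le_iff.2 ⟨by linarith, ?_⟩
    nlinarith
  have hle : Real.log (p n) ≤ a / 2 * n := by
    rw [Real.norm_eq_abs, Real.norm_of_nonneg (Real.sqrt_nonneg _)] at hb
    exact (le_abs_self _).trans (hb.trans (by gcongr))
  calc (p n : ℝ) * Real.exp (-(n * a)) = Real.exp (Real.log (p n) + -(n * a)) := by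
        rw [Real.exp_add, Real.exp_log hp0]
    _ ≤ _ := Real.exp_le_exp.2 (by linarith)

theorem tendsto_dim_mul_exp_neg_log (hp : Tendsto p atTop atTop) :
    Tendsto (fun n => (p n : ℝ) * Real.exp (-Real.log (1 + (p n : ℝ) ^ 2))) atTop (𝓝 0) := by
  have h1 : Tendsto (fun n => ((p n : ℝ))⁻¹) atTop (𝓝 0) :=
    tendsto_inv_atTop_zero.comp (tendsto_natCast_atTop_atTop.comp hp)
  refine squeeze_zero' (Eventually.of_forall fun n => by positivity) ?_ h1
  filter_upwards [hp.eventually_ge_atTop 1] with n hn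
  have hp0 : (0 : ℝ) < p n := by exact_mod_cast hn
  rw [Real.exp_neg, Real.exp_log (by positivity), ← div_eq_mul_inv, div_le_iff₀ (by positivity)]
  rw [inv_mul_eq_div, le_div_iff₀ hp0]
  nlinarith

theorem tendsto_dim_sq_mul_exp_neg {c : ℝ} (hc : 0 < c) (hp : Tendsto p atTop atTop) :
    Tendsto (fun n => (p n : ℝ) * (p n * Real.exp (-(c * Real.log (1 + (p n : ℝ) ^ 2) ^ 2))))
      atTop (𝓝 0) := by
  have hl := tendsto_log_one_add_sq hp
  have h1 : Tendsto (fun n => Real.exp (-Real.log (1 + (p n : ℝ) ^ 2))) atTop (𝓝 0) :=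
    Real.tendsto_exp_neg_atTop_nhds_zero.comp hl
  refine squeeze_zero' (Eventually.of_forall fun n => by positivity) ?_ h1
  filter_upwards [hl.eventually_ge_atTop (2 / c), hl.eventually_ge_atTop 0] with n hn hn0
  have h2 : (p n : ℝ) * p n ≤ Real.exp (Real.log (1 + (p n : ℝ) ^ 2)) := by
    rw [Real.exp_log (by positivity)]; nlinarith
  rw [div_le_iff₀ hc] at hn
  calc _ = (p n : ℝ) * p n * Real.exp (-(c * Real.log (1 + (p n : ℝ) ^ 2) ^ 2)) := by ring
    _ ≤ Real.exp (Real.log (1 + (p n : ℝ) ^ 2))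
        * Real.exp (-(c * Real.log (1 + (p n : ℝ) ^ 2) ^ 2)) := by gcongr
    _ ≤ _ := by
        rw [← Real.exp_add]
        refine Real.exp_le_exp.2 ?_
        nlinarith

theorem exists_mul_le_tuning (hγ_pos : ∀ n, 0 < γ n) {f : ℕ → ℝ} (hγ : γ =Θ[atTop] f)
    (hf : ∀ n, 0 ≤ f n) : ∃ g : ℝ, 0 < g ∧ ∀ᶠ n in atTop, g * f n ≤ γ n := by
  obtain ⟨C, hC, hb⟩ := hγ.2.exists_pos
  refine ⟨C⁻¹, inv_pos.2 hC, ?_⟩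
  filter_upwards [hb.bound] with n hn
  rw [Real.norm_of_nonneg (hf n), Real.norm_of_nonneg (hγ_pos n).le] at hn
  rwa [inv_mul_le_iff₀ hC]

end Sequences

theorem tendsto_measure_score_row {Ω : Type*} {F₀ : MeasurableSpace Ω}
    [mΩ : MeasurableSpace Ω] {P : Measure Ω} [IsProbabilityMeasure P] {W : ℕ → ℝ≥0 → Ω → ℝ}
    (hW : IsBrownianBasis F₀ P W) {p : ℕ → ℕ} {Δ γ : ℕ → ℝ} {φ : ℕ → ℝ → ℝ} {Θ : ℕ → ℕ → ℝ}
    {σ : ℕ → ℝ} {X : (n : ℕ) → ℝ≥0 → Ω → Fin (p n) → ℝ}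
    (hX : ∀ n, IsSolution F₀ P W φ Θ σ (X n)) (hreg : Regularity P p Δ φ Θ σ X) {B : ℝ}
    (hB0 : 0 ≤ B) (hB : ∀ n (i : Fin (p n)), l1Norm (row Θ i) ≤ B) (hγ_pos : ∀ n, 0 < γ n)
    (hγ : γ =Θ[atTop] fun n => Real.log (1 + (p n : ℝ) ^ 2) / √(n * Δ n)) :
    Tendsto (fun n => P {ω | ¬ ∀ i,
      ‖score φ n (Δ n) (fun t => X n t ω) i (row Θ i)‖ ≤ γ n / 2}) atTop (𝓝 0) := by
  obtain ⟨L, hL0, hL⟩ := hreg.bounded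
  obtain ⟨L', hL'0, hL'⟩ := hreg.lipschitz
  obtain ⟨K, κ, hK0, hκ0, hKκ⟩ := hreg.diffusion_bounds
  obtain ⟨α, hα1, hα2, hΔθ⟩ := hreg.step_order
  obtain ⟨a, ha0, ha⟩ := exists_gaussianSqLaplace_le
  have hp := hreg.dim_tendsto
  have hΔ0 := tendsto_step (by linarith) hΔθ
  have hl := tendsto_log_one_add_sq hp
  set ℓ : ℕ → ℝ := fun n => Real.log (1 + (p n : ℝ) ^ 2) with hℓ
  have hℓ0 : ∀ n, 0 ≤ ℓ n := fun n => Real.log_nonneg (by nlinarith [sq_nonneg (p n : ℝ)])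
  obtain ⟨g, hg0, hg⟩ := exists_mul_le_tuning hγ_pos hγ fun n =>
    div_nonneg (hℓ0 n) (Real.sqrt_nonneg _)
  set c : ℝ := κ ^ 2 * a / 4 with hc
  have hc0 : 0 < c := by positivity
  set η : ℝ := g * c / (4 * K) with hη
  have hη0 : 0 < η := by positivity
  set e : ℝ := η ^ 2 / (2 * L ^ 2) with he
  have he0 : 0 < e := by positivity
  have hbound : Tendsto (fun n =>
      (p n : ℝ≥0∞) * (p n * (2 * ENNReal.ofReal (Real.exp (-(e * ℓ n ^ 2)))))
        + p n * (2 * ENNReal.ofReal (Real.exp (1 / 2)) * ENNReal.ofReal (Real.exp (-ℓ n)))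
        + p n * ENNReal.ofReal (Real.exp (-(n * a)))) atTop (𝓝 0) := by
    have hreal : Tendsto (fun n => 2 * ((p n : ℝ) * (p n * Real.exp (-(e * ℓ n ^ 2))))
        + 2 * Real.exp (1 / 2) * (p n * Real.exp (-ℓ n))
        + p n * Real.exp (-(n * a))) atTop (𝓝 0) := by
      simpa using (((tendsto_dim_sq_mul_exp_neg he0 hp).const_mul 2).add
        ((tendsto_dim_mul_exp_neg_log hp).const_mul (2 * Real.exp (1 / 2)))).add
        (tendsto_dim_mul_exp_neg ha0 hp hreg.log_dim hΔ0)
    have h := ENNReal.tendsto_ofReal hreal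
    rw [ENNReal.ofReal_zero] at h
    refine h.congr fun n => ?_
    rw [ENNReal.ofReal_add (by positivity) (by positivity),
      ENNReal.ofReal_add (by positivity) (by positivity)]
    have h2 : ENNReal.ofReal 2 = 2 := by simp
    simp only [ENNReal.ofReal_mul, Nat.cast_nonneg, ENNReal.ofReal_natCast, zero_le_two, h2,
      (Real.exp_pos _).le, mul_nonneg]
    ring
  refine tendsto_of_tendsto_of_tendsto_of_le_of_le' tendsto_const_nhds hbound
    (Eventually.of_forall fun _ => zero_le) ?_
  have hev1 : ∀ᶠ n in atTop, (B * L) ^ 2 * Δ n < c := by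
    have h : Tendsto (fun n => (B * L) ^ 2 * Δ n) atTop (𝓝 0) := by
      simpa using hΔ0.const_mul ((B * L) ^ 2)
    exact h.eventually_lt_const hc0
  have hev2 : ∀ᶠ n : ℕ in atTop, L * L' * B * (B * L + K) * (√n * Δ n) < g * c / 4 := by
    have h : Tendsto (fun n : ℕ => L * L' * B * (B * L + K) * (√n * Δ n)) atTop (𝓝 0) := by
      simpa using (tendsto_sqrt_mul_step hα1 hΔθ).const_mul (L * L' * B * (B * L + K))
    exact h.eventually_lt_const (by positivity)
  filter_upwards [hev1, hev2, hg, eventually_ge_atTop 1, hl.eventually_ge_atTop 1,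
    hΔ0.eventually_le_const zero_lt_one] with n h1 h2 hgn hn hℓ1 hΔ1
  have hδ := hreg.step_pos n hn
  have hn0 : (0 : ℝ) < n := by exact_mod_cast hn
  have hT : 0 < n * Δ n := by positivity
  have hsT : 0 < √(n * Δ n) := Real.sqrt_pos.2 hT
  have hsT2 : √(n * Δ n) ^ 2 = n * Δ n := Real.sq_sqrt hT.le
  have hm : 0 < η * √(n * Δ n) * ℓ n := by positivity
  have hmain := measure_score_row_gt_le hW (hX n) hL0 hL hL'0.le hL' (hB n)
    (fun i => (hKκ i).2.le) hκ0.le (fun i => (hKκ i).1.le) hn hδ (a := a) (b := ℓ n) (c := c)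
    (m := η * √(n * Δ n) * ℓ n) ha hc0 (by rw [hc] at h1 ⊢; linarith) hm
  have hexp : (η * √(n * Δ n) * ℓ n) ^ 2 / (2 * L ^ 2 * (n * Δ n)) = e * ℓ n ^ 2 := by
    rw [he, mul_pow, mul_pow, hsT2]; field_simp
  rw [hexp] at hmain
  refine le_trans (measure_mono fun ω hω => ?_) hmain
  refine fun hgood => hω fun i => (hgood i).trans ?_
  refine le_trans ?_ (div_le_div_of_nonneg_right hgn zero_le_two)
  have hsδ : 0 < √(Δ n) := Real.sqrt_pos.2 hδ
  have hδle : Δ n ≤ ℓ n * √(Δ n) := by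
    have h3 : √(Δ n) ≤ 1 := Real.sqrt_le_one.2 hΔ1
    have h4 : Δ n = √(Δ n) * √(Δ n) := (Real.mul_self_sqrt hδ.le).symm
    nlinarith
  have hsplit : √(n * Δ n) * √(Δ n) = √n * Δ n := by
    rw [Real.sqrt_mul hn0.le, mul_assoc, Real.mul_self_sqrt hδ.le]
  set s := √(n * Δ n) with hs
  rw [div_le_iff₀ (by positivity)]
  have hKη : K * η = g * c / 4 := by rw [hη]; field_simp
  have hA : L * L' * B * (n * (B * L * Δ n ^ 2) + K * (ℓ n * √(Δ n) * (n * Δ n)))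
      ≤ ℓ n * s * (g * c / 4) := by
    calc _ = L * L' * B * (n * Δ n) * (B * L * Δ n + K * (ℓ n * √(Δ n))) := by ring
      _ ≤ L * L' * B * (n * Δ n) * (B * L * (ℓ n * √(Δ n)) + K * (ℓ n * √(Δ n))) := by gcongr
      _ = ℓ n * s * (L * L' * B * (B * L + K) * (s * √(Δ n))) := by rw [← hsT2]; ring
      _ ≤ _ := by rw [hsplit]; gcongr
  calc _ ≤ ℓ n * s * (g * c / 4) + K * (η * s * ℓ n) := add_le_add hA le_rfl
    _ = ℓ n * s * (g * c / 2) := by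
        rw [show K * (η * s * ℓ n) = K * η * (s * ℓ n) by ring, hKη]; ring
    _ = _ := by rw [← hsT2]; field_simp; rfl

/-! ### Sparsity -/

section Sparsity

variable {Θ : ℕ → ℕ → ℝ} {S : ℕ}

theorem mem_rowSupport {d : ℕ} {i j : Fin d} : j ∈ rowSupport Θ i ↔ Θ i j ≠ 0 :=
  Finset.mem_filter.trans (and_iff_right (Finset.mem_univ j))

theorem card_rowSupport_le (hS : (⨆ i, {j | Θ i j ≠ 0}.encard) = (S : ℕ∞)) {d : ℕ} (i : Fin d) :
    (rowSupport Θ i).card ≤ S := by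
  have h1 : ((rowSupport Θ i : Finset (Fin d)) : Set (Fin d)).encard ≤ {j | Θ i j ≠ 0}.encard := by
    rw [← Fin.val_injective.injOn.encard_image]
    refine Set.encard_le_encard ?_
    rintro _ ⟨j, hj, rfl⟩
    exact mem_rowSupport.1 (Finset.mem_coe.1 hj)
  have h2 := (h1.trans (le_iSup (fun i : ℕ => {j | Θ i j ≠ 0}.encard) i)).trans_eq hS
  rw [Set.encard_coe_eq_coe_finsetCard] at h2
  exact_mod_cast h2

theorem l1Norm_row_le (hS : (⨆ i, {j | Θ i j ≠ 0}.encard) = (S : ℕ∞)) {C : ℝ}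
    (hC : ∀ i j, |Θ i j| ≤ C) {d : ℕ} (i : Fin d) : l1Norm (row Θ i) ≤ S * C := by
  have h0 : 0 ≤ C := (abs_nonneg _).trans (hC 0 0)
  have h1 : l1Norm (row Θ i) = ∑ j ∈ rowSupport Θ i, |row Θ i j| := by
    refine (Finset.sum_subset (Finset.subset_univ _) fun j _ hj => ?_).symm
    have : row Θ i j = 0 := not_not.1 fun h => hj (mem_rowSupport.2 h)
    rw [this, abs_zero]
  rw [h1]
  refine (Finset.sum_le_card_nsmul _ (fun j => |row Θ i j|) C fun j _ => hC i j).trans ?_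
  rw [nsmul_eq_mul]
  exact mul_le_mul_of_nonneg_right (by exact_mod_cast card_rowSupport_le hS i) h0

theorem exists_entry_ne_zero (hS0 : 0 < S) (hS : (⨆ i, {j | Θ i j ≠ 0}.encard) = (S : ℕ∞)) :
    ∃ i j, Θ i j ≠ 0 := by
  by_contra! h
  simp only [h, ne_eq, not_true_eq_false, Set.ofPred_false, Set.encard_empty, iSup_const] at hS
  have : S = 0 := by exact_mod_cast hS.symm
  omega

end Sparsity

/-! ### Measurability of the compatibility factor -/

theorem measurable_kappa {d : ℕ} (T : Finset (Fin d)) :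
    Measurable fun V : Fin d → Fin d → ℝ => kappa T (Matrix.of V) := by
  refine UpperSemicontinuous.measurable ?_
  refine upperSemicontinuous_biInf fun h _ => Continuous.upperSemicontinuous ?_
  have hq : Continuous fun V : Fin d → Fin d → ℝ => quadForm (Matrix.of V) h := by
    simp only [quadForm, dotProduct, Matrix.mulVec, Matrix.of_apply]
    fun_prop
  exact ENNReal.continuous_ofReal.comp ((continuous_const.mul hq.sqrt).div_const _)

theorem IsSolution.measurableSet_lt_iInf_kappa {Ω : Type*} {F₀ : MeasurableSpace Ω}
    [mΩ : MeasurableSpace Ω] {P : Measure Ω} {W : ℕ → ℝ≥0 → Ω → ℝ}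
    (hW : IsBrownianBasis F₀ P W) {φ : ℕ → ℝ → ℝ} (hφ : ∀ i, Measurable (φ i))
    {Θ : ℕ → ℕ → ℝ} {σ : ℕ → ℝ} {d : ℕ} {X : ℝ≥0 → Ω → Fin d → ℝ}
    (hX : IsSolution F₀ P W φ Θ σ X) (n : ℕ) (δ : ℝ) (T : Fin d → Finset (Fin d)) (c : ℝ≥0∞) :
    MeasurableSet {ω | c < ⨅ i, kappa (T i) (hessian φ n δ (fun t => X t ω) i)} := by
  have hXm : ∀ t i, Measurable fun ω => X t ω i := fun t i =>
    (hX.adapted t i).mono (hW.history_le t) le_rfl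
  have hobs : ∀ k i, Measurable fun ω => obs (fun t => X t ω) δ k i := fun k i => hXm _ i
  have hs : ∀ i, Measurable fun ω => sigmaHatSq n δ (fun t => X t ω) i := fun i =>
    (Finset.measurable_fun_sum _ fun k _ =>
      ((hobs (k + 1) i).sub (hobs k i)).abs.pow_const 2).const_mul _
  have hV : ∀ i, Measurable fun ω => fun j l : Fin d => hessian φ n δ (fun t => X t ω) i j l := by
    intro i
    refine measurable_pi_lambda _ fun j => measurable_pi_lambda _ fun l => ?_
    exact (((hs i).const_mul _).const_div _).mul (Finset.measurable_fun_sum _ fun k _ =>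
      ((hφ j).comp (hobs k j)).mul ((hφ l).comp (hobs k l)))
  refine measurableSet_lt measurable_const (Measurable.iInf fun i => ?_)
  exact (measurable_kappa (T i)).comp (hV i)

/-! ### Error bounds and consistency -/

section Main

variable {Ω : Type*} [mΩ : MeasurableSpace Ω] {P : Measure Ω} {p : ℕ → ℕ} {Δ γ : ℕ → ℝ}
  {φ : ℕ → ℝ → ℝ} {Θ : ℕ → ℕ → ℝ} {X : (n : ℕ) → ℝ≥0 → Ω → Fin (p n) → ℝ}
  {Θhat : (n : ℕ) → Ω → Fin (p n) → Fin (p n) → ℝ}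

/-- The oracle inequality for a matrix factor `F` that controls the functional `N`. -/
theorem tendsto_measure_bound_le
    {F : {d : ℕ} → Finset (Fin d) → Matrix (Fin d) (Fin d) ℝ → ℝ≥0∞}
    {N : {d : ℕ} → (Fin d → ℝ) → ℝ}
    (hFN : ∀ {d : ℕ} (T : Finset (Fin d)) V h, 0 ≤ quadForm V h → h ∈ cone T →
      F T V ^ 2 * ENNReal.ofReal (N h ^ 2) ≤ ENNReal.ofReal (quadForm V h))
    (hF : ∀ {d : ℕ} (T : Finset (Fin d)) V, T.Nonempty → F T V ≠ ⊤)
    (hp : Tendsto p atTop atTop) (hΔ : ∀ n, 1 ≤ n → 0 < Δ n) (hΘ : ∃ i j, Θ i j ≠ 0)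
    (hγ_pos : ∀ n, 0 < γ n)
    (hΘhat : ∀ n, ∀ᵐ ω ∂P, ∀ i,
      IsDantzigSelector φ n (Δ n) (γ n) (fun t => X n t ω) i (Θhat n ω i))
    (hscore : Tendsto (fun n => P {ω | ¬ ∀ i,
      ‖score φ n (Δ n) (fun t => X n t ω) i (row Θ i)‖ ≤ γ n / 2}) atTop (𝓝 0)) :
    Tendsto (fun n => P {ω | boundNumerator Θ (p n) (γ n) /
        (⨅ i : Fin (p n), F (rowSupport Θ i) (hessian φ n (Δ n) (fun t => X n t ω) i) ^ 2)
        ≤ ⨆ i : Fin (p n), ENNReal.ofReal (N (Θhat n ω i - row Θ i) ^ 2)}) atTop (𝓝 0) := by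
  obtain ⟨i₀, j₀, hij⟩ := hΘ
  refine tendsto_of_tendsto_of_tendsto_of_le_of_le' tendsto_const_nhds hscore
    (Eventually.of_forall fun _ => zero_le) ?_
  filter_upwards [eventually_ge_atTop 1, hp.eventually_gt_atTop i₀, hp.eventually_gt_atTop j₀]
    with n hn hi hj
  refine measure_mono_ae ?_
  filter_upwards [hΘhat n] with ω hω hbad hgood
  have hδ := hΔ n hn
  have : Nonempty (Fin (p n)) := ⟨⟨i₀, hi⟩⟩
  have hTne : (rowSupport Θ (⟨i₀, hi⟩ : Fin (p n))).Nonempty :=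
    ⟨⟨j₀, hj⟩, mem_rowSupport.2 hij⟩
  refine absurd (iSup_lt_div_iInf (ι := Fin (p n))
    (R := fun i => F (rowSupport Θ i) (hessian φ n (Δ n) (fun t => X n t ω) i) ^ 2)
    (S := fun i => ENNReal.ofReal (N (Θhat n ω i - row Θ i) ^ 2))
    (A := fun i => ENNReal.ofReal (l1Norm (row Θ i))) (g := ENNReal.ofReal (γ n))
    (fun i => ?_) (fun _ => ENNReal.ofReal_ne_top) ⟨⟨i₀, hi⟩, ?_⟩ (fun _ => ENNReal.ofReal_ne_top)
    (by simpa using hγ_pos n) ENNReal.ofReal_ne_top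
    ⟨⟨i₀, hi⟩, ENNReal.pow_ne_top (hF _ _ hTne)⟩) (not_lt.2 hbad)
  · have hs := hgood i
    have hc := (hω i).sub_row_mem_cone (Θ := Θ) (hs.trans (by linarith [hγ_pos n]))
    refine (hFN _ _ _ (quadForm_hessian_nonneg φ n _ i hδ.le _) hc).trans ?_
    refine (ENNReal.ofReal_le_ofReal
      ((hω i).quadForm_sub_row_le hδ.ne' (hγ_pos n) hs)).trans_eq ?_
    have h0 := l1Norm_nonneg (row Θ i)
    rw [ENNReal.ofReal_mul (by positivity), ENNReal.ofReal_mul (by positivity)]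
    simp
  · rw [ne_eq, ENNReal.ofReal_eq_zero, not_le]
    refine lt_of_lt_of_le (norm_pos_iff.2 ?_) (norm_le_l1Norm (row Θ (⟨i₀, hi⟩ : Fin (p n))))
    exact fun h => hij (congrFun h ⟨j₀, hj⟩)

theorem tendsto_measure_l1Norm_sub_gt [IsProbabilityMeasure P] {S : ℕ} {B : ℝ}
    (hB : ∀ n (i : Fin (p n)), l1Norm (row Θ i) ≤ B)
    (hS : ∀ n (i : Fin (p n)), (rowSupport Θ i).card ≤ S)
    (hΔ : ∀ n, 1 ≤ n → 0 < Δ n) (hγ_pos : ∀ n, 0 < γ n) (hγ0 : Tendsto γ atTop (𝓝 0))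
    (hκm : ∀ n (c : ℝ≥0∞), MeasurableSet {ω | c < ⨅ i : Fin (p n),
      kappa (rowSupport Θ i) (hessian φ n (Δ n) (fun t => X n t ω) i)})
    (hcompat : CompatibilityCondition P p Δ φ Θ X)
    (hΘhat : ∀ n, ∀ᵐ ω ∂P, ∀ i,
      IsDantzigSelector φ n (Δ n) (γ n) (fun t => X n t ω) i (Θhat n ω i))
    (hscore : Tendsto (fun n => P {ω | ¬ ∀ i,
      ‖score φ n (Δ n) (fun t => X n t ω) i (row Θ i)‖ ≤ γ n / 2}) atTop (𝓝 0))
    {ε : ℝ} (hε : 0 < ε) :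
    Tendsto (fun n => P {ω | ¬ ∀ i, l1Norm (Θhat n ω i - row Θ i) ≤ ε}) atTop (𝓝 0) := by
  rw [ENNReal.tendsto_nhds_zero]
  intro τ hτ
  obtain ⟨τ', hτ'0, hτ'⟩ : ∃ τ' : ℝ, 0 < τ' ∧ ENNReal.ofReal τ' ≤ τ / 2 := by
    obtain ⟨r, hr0, hr⟩ := ENNReal.lt_iff_exists_nnreal_btwn.1 (ENNReal.half_pos hτ.ne')
    exact ⟨r, by exact_mod_cast hr0, by simpa using hr.le⟩
  obtain ⟨c, hc, n₀, hn₀⟩ := hcompat τ' hτ'0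
  have hγ1 : ∀ᶠ n in atTop, 12 * S * B * γ n < c ^ 2 * ε ^ 2 := by
    have h : Tendsto (fun n => 12 * S * B * γ n) atTop (𝓝 0) := by
      simpa using hγ0.const_mul (12 * S * B)
    exact h.eventually_lt_const (by positivity)
  filter_upwards [eventually_ge_atTop 1, eventually_ge_atTop n₀, hγ1,
    (ENNReal.tendsto_nhds_zero.1 hscore) (τ / 2) (ENNReal.half_pos hτ.ne')] with n hn hn0 hγn hsc
  have hδ := hΔ n hn
  set A : Set Ω := {ω | ENNReal.ofReal c < ⨅ i : Fin (p n),
    kappa (rowSupport Θ i) (hessian φ n (Δ n) (fun t => X n t ω) i)} with hA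
  have hAc : P Aᶜ ≤ τ / 2 := by
    rw [prob_compl_eq_one_sub (hκm n _)]
    refine le_trans ?_ hτ'
    rw [tsub_le_iff_left, ← tsub_le_iff_right]
    exact hn₀ n hn0
  refine le_trans ?_ (((measure_union_le Aᶜ {ω | ¬ ∀ i,
    ‖score φ n (Δ n) (fun t => X n t ω) i (row Θ i)‖ ≤ γ n / 2}).trans
      (add_le_add hAc hsc)).trans_eq (ENNReal.add_halves τ))
  refine measure_mono_ae ?_
  filter_upwards [hΘhat n] with ω hω hbad
  by_contra hgood
  change ω ∉ Aᶜ ∪ _ at hgood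
  simp only [Set.mem_union, not_or, Set.notMem_compl_iff] at hgood
  obtain ⟨hωA, hωs⟩ := hgood
  have hωs' : ∀ i, ‖score φ n (Δ n) (fun t => X n t ω) i (row Θ i)‖ ≤ γ n / 2 := not_not.1 hωs
  refine hbad fun i => ?_
  have hs := hωs' i
  have hcone := (hω i).sub_row_mem_cone (Θ := Θ) (hs.trans (by linarith [hγ_pos n]))
  have hq0 := quadForm_hessian_nonneg φ n (fun t => X n t ω) i hδ.le (Θhat n ω i - row Θ i)
  have hq := (hω i).quadForm_sub_row_le hδ.ne' (hγ_pos n) hs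
  have hκ := sq_l1Norm_le_of_lt_kappa hc hq0 (lt_of_lt_of_le hωA (iInf_le _ i)) hcone
  have hq2 : quadForm (hessian φ n (Δ n) (fun t => X n t ω) i) (Θhat n ω i - row Θ i)
      ≤ 3 * B * γ n := by
    refine hq.trans ?_
    have := hB n i
    have := (hγ_pos n).le
    gcongr
  have hcard : ((rowSupport Θ i).card : ℝ) ≤ S := by exact_mod_cast hS n i
  have hle : c ^ 2 * l1Norm (Θhat n ω i - row Θ i) ^ 2 ≤ c ^ 2 * ε ^ 2 := by
    calc _ ≤ 4 * ((rowSupport Θ i).card : ℝ) * _ := hκ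
      _ ≤ 4 * S * (3 * B * γ n) := by gcongr
      _ ≤ _ := by linarith
  exact le_of_sq_le_sq (le_of_mul_le_mul_left hle (by positivity)) hε.le

theorem tendstoInMeasure_iSup {N : {d : ℕ} → (Fin d → ℝ) → ℝ}
    (hN0 : ∀ {d : ℕ} (v : Fin d → ℝ), 0 ≤ N v) (hN : ∀ {d : ℕ} (v : Fin d → ℝ), N v ≤ l1Norm v)
    (h : ∀ ε : ℝ, 0 < ε →
      Tendsto (fun n => P {ω | ¬ ∀ i, l1Norm (Θhat n ω i - row Θ i) ≤ ε}) atTop (𝓝 0)) :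
    TendstoInMeasure P (fun n ω => ⨆ i : Fin (p n), N (Θhat n ω i - row Θ i)) atTop
      fun _ => 0 := by
  rw [tendstoInMeasure_iff_norm]
  intro ε hε
  refine tendsto_of_tendsto_of_tendsto_of_le_of_le tendsto_const_nhds (h (ε / 2) (half_pos hε))
    (fun _ => zero_le) fun n => measure_mono fun ω hω hgood => ?_
  have hω' : ε ≤ ‖(⨆ i : Fin (p n), N (Θhat n ω i - row Θ i)) - 0‖ := hω
  rw [sub_zero, Real.norm_of_nonneg (Real.iSup_nonneg fun i => hN0 _)] at hω'
  have := Real.iSup_le (fun i => (hN (Θhat n ω i - row Θ i)).trans (hgood i)) (half_pos hε).le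
  linarith

end Main

end SparseDiffusion

theorem theorem4p6 {Ω : Type*} (F₀ : MeasurableSpace Ω) [mΩ : MeasurableSpace Ω]
    (P : Measure Ω) [IsProbabilityMeasure P]
    (W : ℕ → ℝ≥0 → Ω → ℝ) (hW : SparseDiffusion.IsBrownianBasis F₀ P W)
    (p : ℕ → ℕ) (Δ : ℕ → ℝ) (φ : ℕ → ℝ → ℝ) (Θ₀ : ℕ → ℕ → ℝ) (σ₀ : ℕ → ℝ)
    (X : (n : ℕ) → ℝ≥0 → Ω → Fin (p n) → ℝ)
    (hX : ∀ n, SparseDiffusion.IsSolution F₀ P W φ Θ₀ σ₀ (X n))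
    (Sstar : ℕ) (hSstar : 0 < Sstar)
    (hsparse : (⨆ i, {j | Θ₀ i j ≠ 0}.encard) = (Sstar : ℕ∞))
    (hreg : SparseDiffusion.Regularity P p Δ φ Θ₀ σ₀ X)
    (hcompat : SparseDiffusion.CompatibilityCondition P p Δ φ Θ₀ X)
    (γ : ℕ → ℝ) (hγ_pos : ∀ n, 0 < γ n)
    (hγ : γ =Θ[atTop] fun n => Real.log (1 + (p n : ℝ) ^ 2) / √(n * Δ n))
    (Θhat : (n : ℕ) → Ω → Fin (p n) → Fin (p n) → ℝ)
    (hΘhat : ∀ n, ∀ᵐ ω ∂P, ∀ i,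
      SparseDiffusion.IsDantzigSelector φ n (Δ n) (γ n) (fun t => X n t ω) i (Θhat n ω i)) :
    (Tendsto (fun n => P {ω |
        SparseDiffusion.boundNumerator Θ₀ (p n) (γ n) /
            (⨅ i : Fin (p n), SparseDiffusion.RE (SparseDiffusion.rowSupport Θ₀ i)
              (SparseDiffusion.hessian φ n (Δ n) (fun t => X n t ω) i) ^ 2)
          ≤ ⨆ i : Fin (p n), ENNReal.ofReal
              (SparseDiffusion.l2Norm (Θhat n ω i - SparseDiffusion.row Θ₀ i) ^ 2)})
        atTop (𝓝 0) ∧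
      TendstoInMeasure P
        (fun n ω => ⨆ i : Fin (p n),
          SparseDiffusion.l2Norm (Θhat n ω i - SparseDiffusion.row Θ₀ i))
        atTop (fun _ => 0)) ∧
    (Tendsto (fun n => P {ω |
        SparseDiffusion.boundNumerator Θ₀ (p n) (γ n) /
            (⨅ i : Fin (p n), SparseDiffusion.FInfty (SparseDiffusion.rowSupport Θ₀ i)
              (SparseDiffusion.hessian φ n (Δ n) (fun t => X n t ω) i) ^ 2)
          ≤ ⨆ i : Fin (p n), ENNReal.ofReal
              (‖Θhat n ω i - SparseDiffusion.row Θ₀ i‖ ^ 2)})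
        atTop (𝓝 0) ∧
      TendstoInMeasure P
        (fun n ω => ⨆ i : Fin (p n), ‖Θhat n ω i - SparseDiffusion.row Θ₀ i‖)
        atTop (fun _ => 0)) := by
  obtain ⟨C, _, hC0, -, hC, -⟩ := hreg.drift_bounds
  obtain ⟨L', hL'0, hL'⟩ := hreg.lipschitz
  obtain ⟨α, hα1, hα2, hΔθ⟩ := hreg.step_order
  have hB : ∀ n (i : Fin (p n)),
      SparseDiffusion.l1Norm (SparseDiffusion.row Θ₀ i) ≤ Sstar * C := fun n i =>
    SparseDiffusion.l1Norm_row_le hsparse (fun i j => (hC i j).le) i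
  have hB0 : (0 : ℝ) ≤ Sstar * C := by positivity
  have hΘ := SparseDiffusion.exists_entry_ne_zero hSstar hsparse
  have hscore := SparseDiffusion.tendsto_measure_score_row hW hX hreg hB0 hB hγ_pos hγ
  have hγ0 := SparseDiffusion.tendsto_tuning hreg.dim_tendsto hreg.log_dim
    (SparseDiffusion.tendsto_horizon hα2 hreg.step_pos hΔθ) hγ
  have hl1 : ∀ ε : ℝ, 0 < ε → Tendsto (fun n => P {ω | ¬ ∀ i,
      SparseDiffusion.l1Norm (Θhat n ω i - SparseDiffusion.row Θ₀ i) ≤ ε}) atTop (𝓝 0) :=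
    fun ε hε => SparseDiffusion.tendsto_measure_l1Norm_sub_gt hB
      (fun n i => SparseDiffusion.card_rowSupport_le hsparse i) hreg.step_pos hγ_pos hγ0
      (fun n c => (hX n).measurableSet_lt_iInf_kappa hW (fun i =>
        (SparseDiffusion.continuous_of_lipschitz_bound hL'0.le (hL' i)).measurable) n (Δ n) _ c)
      hcompat hΘhat hscore hε
  refine ⟨⟨?_, ?_⟩, ?_, ?_⟩
  · exact SparseDiffusion.tendsto_measure_bound_le (F := SparseDiffusion.RE)
      (N := SparseDiffusion.l2Norm) (fun _ _ _ => SparseDiffusion.RE_sq_mul_le)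
      (fun _ _ => SparseDiffusion.RE_ne_top) hreg.dim_tendsto hreg.step_pos hΘ hγ_pos hΘhat hscore
  · exact SparseDiffusion.tendstoInMeasure_iSup (N := SparseDiffusion.l2Norm)
      (fun _ => Real.sqrt_nonneg _) SparseDiffusion.l2Norm_le_l1Norm hl1
  · exact SparseDiffusion.tendsto_measure_bound_le (F := SparseDiffusion.FInfty)
      (N := fun v => ‖v‖) (fun _ _ _ => SparseDiffusion.FInfty_sq_mul_le)
      (fun _ _ => SparseDiffusion.FInfty_ne_top) hreg.dim_tendsto hreg.step_pos hΘ hγ_pos hΘhat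
      hscore
  · exact SparseDiffusion.tendstoInMeasure_iSup (N := fun v => ‖v‖)
      (fun _ => norm_nonneg _) SparseDiffusion.norm_le_l1Norm hl1
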